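/- Let $N\ge 3$ be an integer, let $q\ne 1$ be a positive real number, and sum over repeated upper and lower indices from $1$ to $N$. Put $i'=N+1-i$, let $(P)$ be $1$ if the condition $P$ holds and $0$ otherwise, let $\varrho_i=\frac N2-i$, $0$, $\frac N2-i+1$ according as $i<\frac{N+1}2$, $i=\frac{N+1}2$, $i>\frac{N+1}2$, and define $$C^{ij}=C_{ij}=q^{-\varrho_i}(i=j'),\qquad K^{kl}_{ij}=C^{ij}C_{kl},\qquad I^{kl}_{ij}=(i=k)(j=l),$$ $$R^{kl}_{ij}=q^{(k=l)-(k=l')}(i=l)(j=k)+(q-q^{-1})(i<l)\bigl(I^{kl}_{ij}-K^{kl}_{ij}\bigr),\qquad R^-=R-(q-q^{-1})I+(q-q^{-1})K .$$ Let $X$ (the quantum Euclidean sphere $S_q^{N-1}$) be the unital $*$-algebra over $\mathbb C$ with generators $x_1,\dots,x_N$, relations $$(R^-)^{kl}_{ij}x_kx_l=q^{-1}x_ix_j+\frac{q^{N-1}-q^{N-3}}{1+q^{N-2}}K^{kl}_{ij}x_kx_l,\qquad C^{kl}x_kx_l=1,$$ and involution $x_i^*=C^{ij}x_j$. For a sign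 $\varepsilon\in\{1,-1\}$ let $(\Gamma_\varepsilon,\mathrm d)$ (that is, $\Gamma_+$ for $\varepsilon=1$ and $\Gamma_-$ for $\varepsilon=-1$) be the first order differential calculus on $X$ whose bimodule of one-forms is the quotient of the bimodule of universal one-forms over $X$ by the relations $$\mathrm dx_i\cdot x_j=\varepsilon (R^-)^{kl}_{ij}x_k\,\mathrm dx_l+(\varepsilon q-1)x_i\,\mathrm dx_j+\frac{q^N-q^{N-2}}{1-\varepsilon q^{N-1}}K^{kl}_{ij}x_k\,\mathrm dx_l+\frac{(1-\varepsilon q)(1+q^{N-2})}{1-\varepsilon q^{N-1}}C^{kl}x_ix_jx_k\,\mathrm dx_l .$$ Put $\eta=C^{kl}x_k\,\mathrm dx_l$ and $$\gamma^\pm_i=\mathrm dx_i+\alpha^\pm x_i\eta,\qquad \alpha^+=-\frac{1+q^{N-2}}{1-\varepsilon q^{N-1}},\qquad \alpha^-=\varepsilon q\,\frac{1+q^{N-2}}{1-\varepsilon q^{N-1}} .$$ Then $(\Gamma_\varepsilon,\mathrm d)$ is a $*$-calculus (that is, $\sum_k a_k\,\mathrm db_k=0$ implies $\sum_k\mathrm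 d(b_k^*)a_k^*=0$), so that there is exactly one conjugate linear involution $*$ on $\Gamma_\varepsilon$ with $(\mathrm da)^*=\mathrm d(a^*)$, $(a\omega)^*=\omega^*a^*$ and $(\omega a)^*=a^*\omega^*$ for $a\in X$, $\omega\in\Gamma_\varepsilon$; and for $i=1,\dots,N$ $$(\gamma^+_i)^*=\varepsilon q^{-1}C^{ij}\gamma^-_j,\qquad (\gamma^-_i)^*=\varepsilon q\,C^{ij}\gamma^+_j .$$ -/

import Mathlib

open scoped TensorProduct

noncomputable section

namespace QSphere

/-! ### Matrices of the quantum group `O_q(N)`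

The index `i ∈ {1, …, N}` is `(i : Fin N)` with `(i : ℕ) + 1` in place of `i`; the map
`i ↦ i' = N + 1 - i` is then `Fin.rev`. -/

/-- The constants `ϱ_i`. -/
def rho (N : ℕ) (i : Fin N) : ℝ :=
  if 2 * ((i : ℕ) + 1) < N + 1 then (N : ℝ) / 2 - ((i : ℕ) + 1)
  else if 2 * ((i : ℕ) + 1) = N + 1 then 0
  else (N : ℝ) / 2 - ((i : ℕ) + 1) + 1

/-- `C^{ij} = C_{ij} = q^{-ϱ_i} (i = j')`. -/
def C (N : ℕ) (q : ℝ) (i j : Fin N) : ℝ :=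
  if i = j.rev then q ^ (-rho N i) else 0

/-- `K^{kl}_{ij} = C^{ij} C_{kl}`; the arguments are `k l i j`. -/
def K (N : ℕ) (q : ℝ) (k l i j : Fin N) : ℝ := C N q i j * C N q k l

/-- `I^{kl}_{ij} = (i = k)(j = l)`; the arguments are `k l i j`. -/
def I (N : ℕ) (k l i j : Fin N) : ℝ := if i = k ∧ j = l then 1 else 0

/-- The R-matrix `R^{kl}_{ij}` of `O_q(N)`; the arguments are `k l i j`. -/
def R (N : ℕ) (q : ℝ) (k l i j : Fin N) : ℝ :=
  (if i = l ∧ j = k then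
    q ^ ((if k = l then (1 : ℤ) else 0) - (if k = l.rev then (1 : ℤ) else 0)) else 0)
  + (if i < l then (q - q⁻¹) * (I N k l i j - K N q k l i j) else 0)

/-- The inverse R-matrix `R⁻ = R - (q - q⁻¹) I + (q - q⁻¹) K`; the arguments are `k l i j`. -/
def Rinv (N : ℕ) (q : ℝ) (k l i j : Fin N) : ℝ :=
  R N q k l i j - (q - q⁻¹) * I N k l i j + (q - q⁻¹) * K N q k l i j

/-! ### The `*`-algebra of the quantum Euclidean sphere -/

/-- The defining relations of the quantum Euclidean sphere, in the free algebra on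
`x_1, …, x_N`. -/
inductive Rel (N : ℕ) (q : ℝ) :
    FreeAlgebra ℂ (Fin N) → FreeAlgebra ℂ (Fin N) → Prop
  | comm (i j : Fin N) : Rel N q
      (∑ k, ∑ l, (Rinv N q k l i j : ℂ) • (FreeAlgebra.ι ℂ k * FreeAlgebra.ι ℂ l))
      (((q⁻¹ : ℝ) : ℂ) • (FreeAlgebra.ι ℂ i * FreeAlgebra.ι ℂ j)
        + (((q ^ (N - 1) - q ^ (N - 3)) / (1 + q ^ (N - 2)) : ℝ) : ℂ) •
          ∑ k, ∑ l, (K N q k l i j : ℂ) • (FreeAlgebra.ι ℂ k * FreeAlgebra.ι ℂ l))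
  | norm : Rel N q
      (∑ k, ∑ l, (C N q k l : ℂ) • (FreeAlgebra.ι ℂ k * FreeAlgebra.ι ℂ l)) 1

/-- The coordinate algebra of the quantum Euclidean sphere `S_q^{N-1}`, a unital algebra
over `ℂ`. -/
def Sphere (N : ℕ) (q : ℝ) : Type := RingQuot (Rel N q)

instance (N : ℕ) (q : ℝ) : Ring (Sphere N q) := inferInstanceAs (Ring (RingQuot (Rel N q)))

instance (N : ℕ) (q : ℝ) : Algebra ℂ (Sphere N q) :=
  inferInstanceAs (Algebra ℂ (RingQuot (Rel N q)))

/-- The quotient map from the free algebra. -/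
def mk (N : ℕ) (q : ℝ) : FreeAlgebra ℂ (Fin N) →ₐ[ℂ] Sphere N q :=
  RingQuot.mkAlgHom ℂ (Rel N q)

/-- The generators `x_i`. -/
def x (N : ℕ) (q : ℝ) (i : Fin N) : Sphere N q := mk N q (FreeAlgebra.ι ℂ i)

/-- The value of the involution on the generators: `x_i^* = C^{ij} x_j`. -/
def xStar (N : ℕ) (q : ℝ) (i : Fin N) : Sphere N q := ∑ j, (C N q i j : ℂ) • x N q j

/-- The algebra structure on the opposite algebra of the sphere with the complex conjugate scalar multiplication. -/
abbrev conjAlgebra (N : ℕ) (q : ℝ) : Algebra ℂ (Sphere N q)ᵐᵒᵖ :=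
  RingHom.toAlgebra' ((algebraMap ℂ (Sphere N q)ᵐᵒᵖ).comp (starRingEnd ℂ))
    (fun c a => Algebra.commutes (starRingEnd ℂ c) a)

/-- The conjugate linear anti-homomorphism from the free algebra with `x_i ↦ C^{ij} x_j`. -/
def preStar (N : ℕ) (q : ℝ) : FreeAlgebra ℂ (Fin N) →+* (Sphere N q)ᵐᵒᵖ :=
  letI := conjAlgebra N q
  ((FreeAlgebra.lift ℂ (fun i => MulOpposite.op (xStar N q i)) :
    FreeAlgebra ℂ (Fin N) →ₐ[ℂ] (Sphere N q)ᵐᵒᵖ) : FreeAlgebra ℂ (Fin N) →+* (Sphere N q)ᵐᵒᵖ)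

theorem preStar_ι (N : ℕ) (q : ℝ) (i : Fin N) :
    preStar N q (FreeAlgebra.ι ℂ i) = MulOpposite.op (xStar N q i) := by
  let _ := conjAlgebra N q
  exact FreeAlgebra.lift_ι_apply _ _

theorem preStar_algebraMap (N : ℕ) (q : ℝ) (c : ℂ) :
    preStar N q (algebraMap ℂ _ c) = algebraMap ℂ _ (starRingEnd ℂ c) := by
  let _ := conjAlgebra N q
  exact AlgHom.commutes (FreeAlgebra.lift ℂ (fun i => MulOpposite.op (xStar N q i)) :
    FreeAlgebra ℂ (Fin N) →ₐ[ℂ] (Sphere N q)ᵐᵒᵖ) c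

theorem preStar_smul (N : ℕ) (q : ℝ) (c : ℂ) (w : FreeAlgebra ℂ (Fin N)) :
    preStar N q (c • w) = starRingEnd ℂ c • preStar N q w := by
  rw [Algebra.smul_def, map_mul, preStar_algebraMap, Algebra.smul_def]

theorem preStar_real_smul (N : ℕ) (q : ℝ) (c : ℝ) (w : FreeAlgebra ℂ (Fin N)) :
    preStar N q ((c : ℂ) • w) = (c : ℂ) • preStar N q w := by
  rw [preStar_smul, Complex.conj_ofReal]

theorem rho_rev (N : ℕ) (i : Fin N) : rho N i.rev = -rho N i := by
  have hi := i.isLt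
  have h : ((i.rev : ℕ) : ℝ) + (i : ℕ) + 1 = N := by
    have : (i.rev : ℕ) + (i : ℕ) + 1 = N := by rw [Fin.val_rev]; omega
    exact_mod_cast this
  have h' : (i.rev : ℕ) + (i : ℕ) + 1 = N := by rw [Fin.val_rev]; omega
  unfold rho
  split_ifs <;> first | omega | linarith

/-- The weight `q^{-ϱ_i}`. -/
def wt (N : ℕ) (q : ℝ) (i : Fin N) : ℝ := q ^ (-rho N i)

theorem wt_rev_of_pos (N : ℕ) {q : ℝ} (hq : 0 < q) (i : Fin N) :
    wt N q i * wt N q i.rev = 1 := by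
  unfold wt
  rw [← Real.rpow_add hq, rho_rev]
  simp

theorem xStar_eq (N : ℕ) (q : ℝ) (i : Fin N) :
    xStar N q i = (wt N q i : ℂ) • x N q i.rev := by
  unfold xStar
  rw [Finset.sum_eq_single i.rev]
  · simp [C, wt]
  · intro j _ hj
    have : i ≠ j.rev := fun h => hj (by rw [h, Fin.rev_rev])
    simp [C, this]
  · simp

theorem C_wt (N : ℕ) {q : ℝ} (hq : 0 < q) (k l : Fin N) :
    C N q k l * (wt N q k * wt N q l) = C N q l.rev k.rev := by
  unfold C
  by_cases h : k = l.rev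
  · subst h
    have := wt_rev_of_pos N hq l
    rw [if_pos rfl, if_pos (by rw [Fin.rev_rev])]
    rw [mul_comm (wt N q l.rev), this, mul_one]
  · rw [if_neg h, if_neg, zero_mul]
    intro h'
    exact h (by rw [h', Fin.rev_rev])

theorem K_wt (N : ℕ) {q : ℝ} (hq : 0 < q) (k l i j : Fin N) :
    K N q k l i j * (wt N q k * wt N q l)
      = wt N q i * wt N q j * K N q l.rev k.rev j.rev i.rev := by
  unfold K
  rw [mul_assoc, C_wt N hq, mul_comm (C N q j.rev i.rev), mul_comm (wt N q i * wt N q j),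
    mul_assoc, mul_comm (C N q i j)]
  congr 1
  by_cases h : i = j.rev
  · subst h
    have := wt_rev_of_pos N hq j
    simp only [C, Fin.rev_rev, if_true]
    rw [mul_comm (wt N q j.rev), this, mul_one]
  · have h' : j.rev ≠ i := fun h' => h h'.symm
    simp [C, h, h']

theorem I_wt (N : ℕ) (q : ℝ) (k l i j : Fin N) :
    I N k l i j * (wt N q k * wt N q l)
      = wt N q i * wt N q j * I N l.rev k.rev j.rev i.rev := by
  unfold I
  by_cases h : i = k ∧ j = l
  · obtain ⟨rfl, rfl⟩ := h
    simp
  · have h' : ¬ (j.rev = l.rev ∧ i.rev = k.rev) := by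
      rw [Fin.rev_inj, Fin.rev_inj]
      tauto
    rw [if_neg h, if_neg h']
    ring

theorem I_K_eq_zero (N : ℕ) (q : ℝ) (k l i j : Fin N) (h : ¬ (i < l ↔ k < j)) :
    I N k l i j = 0 ∧ K N q k l i j = 0 := by
  constructor
  · unfold I
    rw [if_neg]
    rintro ⟨rfl, rfl⟩
    exact h Iff.rfl
  · unfold K C
    by_cases h1 : i = j.rev
    · by_cases h2 : k = l.rev
      · subst h1 h2
        exact absurd (by rw [Fin.rev_lt_iff]) h
      · simp [h2]
    · simp [h1]

theorem R_wt (N : ℕ) {q : ℝ} (hq : 0 < q) (k l i j : Fin N) :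
    R N q k l i j * (wt N q k * wt N q l)
      = wt N q i * wt N q j * R N q l.rev k.rev j.rev i.rev := by
  unfold R
  rw [add_mul, mul_add]
  congr 1
  · by_cases h : i = l ∧ j = k
    · obtain ⟨rfl, rfl⟩ := h
      have e1 : (i.rev = j.rev) ↔ (j = i) := by rw [Fin.rev_inj, eq_comm]
      have e2 : (i.rev = j.rev.rev) ↔ (j = i.rev) := by rw [Fin.rev_rev, eq_comm]
      simp only [true_and, if_true, e1, e2]
      ring
    · have h' : ¬ (j.rev = k.rev ∧ i.rev = l.rev) := by
        rw [Fin.rev_inj, Fin.rev_inj]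
        tauto
      rw [if_neg h, if_neg h']
      ring
  · have hI := I_wt N q k l i j
    have hK := K_wt N hq k l i j
    have hr : j.rev < k.rev ↔ k < j := Fin.rev_lt_rev
    by_cases h : i < l ↔ k < j
    · simp only [hr, ← h]
      split_ifs
      · linear_combination (q - q⁻¹) * (hI - hK)
      · ring
    · have z := I_K_eq_zero N q k l i j h
      have z' := I_K_eq_zero N q l.rev k.rev j.rev i.rev (by
        rw [Fin.rev_lt_rev, Fin.rev_lt_rev]
        tauto)
      simp [z.1, z.2, z'.1, z'.2]

theorem Rinv_wt (N : ℕ) {q : ℝ} (hq : 0 < q) (k l i j : Fin N) :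
    Rinv N q k l i j * (wt N q k * wt N q l)
      = wt N q i * wt N q j * Rinv N q l.rev k.rev j.rev i.rev := by
  unfold Rinv
  linear_combination R_wt N hq k l i j - (q - q⁻¹) * I_wt N q k l i j
    + (q - q⁻¹) * K_wt N hq k l i j

theorem preStar_mul_ι (N : ℕ) (q : ℝ) (k l : Fin N) :
    preStar N q (FreeAlgebra.ι ℂ k * FreeAlgebra.ι ℂ l)
      = MulOpposite.op (((wt N q k * wt N q l : ℝ) : ℂ) • (x N q l.rev * x N q k.rev)) := by
  rw [map_mul, preStar_ι, preStar_ι, ← MulOpposite.op_mul, xStar_eq, xStar_eq,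
    smul_mul_smul_comm, Complex.ofReal_mul, mul_comm (wt N q l : ℂ)]

/-- Reindexing of the double sums in the image of the relations under the involution. -/
theorem preStar_sum (N : ℕ) (q : ℝ) (A B : Fin N → Fin N → ℝ) (c : ℝ)
    (h : ∀ k l, A k l * (wt N q k * wt N q l) = c * B l.rev k.rev) :
    preStar N q (∑ k, ∑ l, (A k l : ℂ) • (FreeAlgebra.ι ℂ k * FreeAlgebra.ι ℂ l))
      = MulOpposite.op ((c : ℂ) • mk N q
          (∑ k, ∑ l, (B k l : ℂ) • (FreeAlgebra.ι ℂ k * FreeAlgebra.ι ℂ l))) := by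
  have e : ∀ k l, preStar N q ((A k l : ℂ) • (FreeAlgebra.ι ℂ k * FreeAlgebra.ι ℂ l))
      = MulOpposite.op ((c : ℂ) • ((B l.rev k.rev : ℂ) • (x N q l.rev * x N q k.rev))) := by
    intro k l
    rw [preStar_real_smul, preStar_mul_ι, ← MulOpposite.op_smul, smul_smul, smul_smul,
      ← Complex.ofReal_mul, ← Complex.ofReal_mul, h]
  apply MulOpposite.unop_injective
  simp only [map_sum, e, map_smul, map_mul, Finset.unop_sum, Finset.smul_sum,
    MulOpposite.unop_op]
  rw [Finset.sum_comm]
  refine Fintype.sum_equiv Fin.revPerm _ _ fun l => ?_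
  refine Fintype.sum_equiv Fin.revPerm _ _ fun k => ?_
  rfl

theorem mk_rel (N : ℕ) (q : ℝ) {a b : FreeAlgebra ℂ (Fin N)} (h : Rel N q a b) :
    mk N q a = mk N q b :=
  RingQuot.mkAlgHom_rel ℂ h

theorem preStar_rel (N : ℕ) {q : ℝ} (hq : 0 < q) {a b : FreeAlgebra ℂ (Fin N)}
    (h : Rel N q a b) : preStar N q a = preStar N q b := by
  induction h with
  | comm i j =>
    have hI : preStar N q (FreeAlgebra.ι ℂ i * FreeAlgebra.ι ℂ j)
        = MulOpposite.op (((wt N q i * wt N q j : ℝ) : ℂ) •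
          mk N q (FreeAlgebra.ι ℂ j.rev * FreeAlgebra.ι ℂ i.rev)) := by
      rw [preStar_mul_ι, map_mul]
      rfl
    rw [preStar_sum N q _ (fun k l => Rinv N q k l j.rev i.rev) _
        (fun k l => Rinv_wt N hq k l i j), map_add, preStar_real_smul, preStar_real_smul,
      preStar_sum N q _ (fun k l => K N q k l j.rev i.rev) _ (fun k l => K_wt N hq k l i j),
      hI, mk_rel N q (Rel.comm j.rev i.rev)]
    rw [← MulOpposite.op_smul, ← MulOpposite.op_smul, ← MulOpposite.op_add]
    congr 1
    rw [map_add, map_smul, map_smul, smul_add]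
    congr 1
    · exact smul_comm _ _ _
    · exact smul_comm _ _ _
  | norm =>
    rw [preStar_sum N q _ (fun k l => C N q k l) 1
        (fun k l => by rw [C_wt N hq, one_mul]), mk_rel N q Rel.norm]
    simp

/-- The involution as a ring homomorphism into the opposite algebra. -/
def starHom (N : ℕ) (q : ℝ) [hq : Fact (0 < q)] : Sphere N q →+* (Sphere N q)ᵐᵒᵖ :=
  RingQuot.lift ⟨preStar N q, fun _ _ h => preStar_rel N hq.out h⟩

theorem starHom_mk (N : ℕ) (q : ℝ) [hq : Fact (0 < q)] (w : FreeAlgebra ℂ (Fin N)) :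
    starHom N q (mk N q w) = preStar N q w := by
  have := RingQuot.lift_mkRingHom_apply (preStar N q)
    (r := Rel N q) (fun _ _ h => preStar_rel N hq.out h) w
  rw [← this]
  unfold starHom mk
  rw [← RingQuot.mkAlgHom_coe ℂ (Rel N q)]
  rfl

theorem mk_surjective (N : ℕ) (q : ℝ) : Function.Surjective (mk N q) :=
  RingQuot.mkAlgHom_surjective ℂ (Rel N q)

theorem starHom_x (N : ℕ) (q : ℝ) [Fact (0 < q)] (i : Fin N) :
    starHom N q (x N q i) = MulOpposite.op (xStar N q i) := by
  rw [x, starHom_mk, preStar_ι]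

theorem starHom_smul (N : ℕ) (q : ℝ) [Fact (0 < q)] (c : ℂ) (a : Sphere N q) :
    starHom N q (c • a) = starRingEnd ℂ c • starHom N q a := by
  obtain ⟨w, rfl⟩ := mk_surjective N q a
  rw [← map_smul, starHom_mk, starHom_mk, preStar_smul]

theorem starHom_starHom (N : ℕ) (q : ℝ) [hq : Fact (0 < q)] (a : Sphere N q) :
    (starHom N q (starHom N q a).unop).unop = a := by
  obtain ⟨w, rfl⟩ := mk_surjective N q a
  induction w using FreeAlgebra.induction with
  | grade0 c =>
    rw [AlgHom.commutes, Algebra.algebraMap_eq_smul_one, starHom_smul, map_one,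
      MulOpposite.unop_smul, MulOpposite.unop_one, starHom_smul, map_one]
    simp
  | grade1 i =>
    change (starHom N q (starHom N q (x N q i)).unop).unop = x N q i
    rw [starHom_x, MulOpposite.unop_op, xStar_eq, starHom_smul, starHom_x, xStar_eq,
      Complex.conj_ofReal, ← MulOpposite.op_smul, MulOpposite.unop_op, smul_smul,
      ← Complex.ofReal_mul, wt_rev_of_pos N hq.out, Complex.ofReal_one, one_smul, Fin.rev_rev]
  | mul a b ha hb => simp only [map_mul, MulOpposite.unop_mul, ha, hb]
  | add a b ha hb => simp only [map_add, MulOpposite.unop_add, ha, hb]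

/-- The `*`-structure of the quantum Euclidean sphere: the conjugate linear involutive
anti-automorphism with `x_i^* = C^{ij} x_j`. -/
instance (N : ℕ) (q : ℝ) [Fact (0 < q)] : StarRing (Sphere N q) where
  star a := (starHom N q a).unop
  star_involutive := starHom_starHom N q
  star_mul a b := by simp
  star_add a b := by simp

instance (N : ℕ) (q : ℝ) [Fact (0 < q)] : StarModule ℂ (Sphere N q) where
  star_smul c a := by
    change (starHom N q (c • a)).unop = _
    rw [starHom_smul]
    rfl

theorem star_x (N : ℕ) (q : ℝ) [Fact (0 < q)] (i : Fin N) :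
    star (x N q i) = ∑ j, (C N q i j : ℂ) • x N q j := by
  change (starHom N q (x N q i)).unop = _
  rw [starHom_x]
  rfl

/-! ### First order differential calculi

A bimodule over a `ℂ`-algebra `A` is a module over the enveloping algebra `A ⊗ Aᵐᵒᵖ`. -/

section Calculus

variable {A : Type*} [Ring A] [Algebra ℂ A]
  {M : Type*} [AddCommGroup M] [Module (A ⊗[ℂ] Aᵐᵒᵖ) M]

/-- The left action `a ω` in a bimodule. -/
def lact (a : A) (ω : M) : M := (a ⊗ₜ[ℂ] (1 : Aᵐᵒᵖ)) • ω

/-- The right action `ω a` in a bimodule. -/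
def ract (ω : M) (a : A) : M := ((1 : A) ⊗ₜ[ℂ] MulOpposite.op a) • ω

variable [Module ℂ M]

/-- `(M, d)` is a first order differential calculus: `d` is linear, fulfils the Leibniz rule,
and every one-form is a sum of one-forms `a db`. -/
structure IsFirstOrderCalculus (d : A →ₗ[ℂ] M) : Prop where
  leibniz (a b : A) : d (a * b) = ract (d a) b + lact a (d b)
  span (ω : M) : ∃ (n : ℕ) (a b : Fin n → A), ω = ∑ k, lact (a k) (d (b k))

variable [StarRing A]

/-- `(M, d)` is a `*`-calculus: a first order differential calculus such that
`∑ a_k db_k = 0` always implies `∑ d(b_k^*) a_k^* = 0`. -/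
structure IsStarCalculus (d : A →ₗ[ℂ] M) : Prop extends IsFirstOrderCalculus d where
  star_eq_zero (n : ℕ) (a b : Fin n → A) (h : ∑ k, lact (a k) (d (b k)) = 0) :
    ∑ k, ract (d (star (b k))) (star (a k)) = 0

/-- `s` is the involution `* : M → M` of the `*`-calculus `(M, d)`: the conjugate linear
involution compatible with the bimodule structure such that `(da)^* = d(a^*)`. -/
structure IsFormInvolution (d : A →ₗ[ℂ] M) (s : M → M) : Prop where
  map_add (ω η : M) : s (ω + η) = s ω + s η
  map_smul (c : ℂ) (ω : M) : s (c • ω) = star c • s ω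
  map_lact (a : A) (ω : M) : s (lact a ω) = ract (s ω) (star a)
  map_ract (ω : M) (a : A) : s (ract ω a) = lact (star a) (s ω)
  map_d (a : A) : s (d a) = d (star a)
  involutive (ω : M) : s (s ω) = ω

end Calculus

/-- The bimodule `Ω¹(A) ⊆ A ⊗ Aᵐᵒᵖ` of universal one-forms over `A`, generated by the
universal differentials `1 ⊗ a - a ⊗ 1`. -/
def UniversalForms (A : Type*) [Ring A] [Algebra ℂ A] :
    Submodule (A ⊗[ℂ] Aᵐᵒᵖ) (A ⊗[ℂ] Aᵐᵒᵖ) :=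
  Submodule.span (A ⊗[ℂ] Aᵐᵒᵖ)
    (Set.range fun a : A => (1 : A) ⊗ₜ[ℂ] MulOpposite.op a - a ⊗ₜ[ℂ] (1 : Aᵐᵒᵖ))

instance (A : Type*) [Ring A] [Algebra ℂ A] : AddCommGroup (UniversalForms A) :=
  (UniversalForms A).addCommGroup

/-- The universal differential `a ↦ 1 ⊗ a - a ⊗ 1`. -/
def universalD (A : Type*) [Ring A] [Algebra ℂ A] : A →ₗ[ℂ] UniversalForms A where
  toFun a := ⟨(1 : A) ⊗ₜ[ℂ] MulOpposite.op a - a ⊗ₜ[ℂ] (1 : Aᵐᵒᵖ),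
    Submodule.subset_span ⟨a, rfl⟩⟩
  map_add' a b := by
    ext
    simp only [MulOpposite.op_add, TensorProduct.tmul_add, TensorProduct.add_tmul,
      Submodule.coe_add]
    abel
  map_smul' c a := by
    ext
    simp only [MulOpposite.op_smul, TensorProduct.tmul_smul, ← TensorProduct.smul_tmul',
      RingHom.id_apply, Submodule.coe_smul_of_tower, smul_sub]

/-! ### The calculi `Γ₊` and `Γ₋` on the quantum Euclidean sphere

The sign `ε : ℤˣ` is `1` for `Γ₊` and `-1` for `Γ₋`. -/

/-- For a linear map `d` from the sphere to a bimodule, the difference of the two sides of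
`dx_i · x_j = ε R⁻^{kl}_{ij} x_k dx_l + (ε q - 1) x_i dx_j
  + (q^N - q^{N-2}) / (1 - ε q^{N-1}) K^{kl}_{ij} x_k dx_l
  + (1 - ε q) (1 + q^{N-2}) / (1 - ε q^{N-1}) C^{kl} x_i x_j x_k dx_l`. -/
def bimoduleRelation (N : ℕ) (q : ℝ) (ε : ℤˣ) {M : Type*} [AddCommGroup M]
    [Module (Sphere N q ⊗[ℂ] (Sphere N q)ᵐᵒᵖ) M] [Module ℂ M]
    (d : Sphere N q →ₗ[ℂ] M) (i j : Fin N) : M :=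
  ract (d (x N q i)) (x N q j)
  - ((((ε : ℤ) : ℝ) : ℂ) •
      ∑ k, ∑ l, (Rinv N q k l i j : ℂ) • lact (x N q k) (d (x N q l))
    + ((((ε : ℤ) : ℝ) * q - 1 : ℝ) : ℂ) • lact (x N q i) (d (x N q j))
    + (((q ^ N - q ^ (N - 2)) / (1 - ((ε : ℤ) : ℝ) * q ^ (N - 1)) : ℝ) : ℂ) •
      ∑ k, ∑ l, (K N q k l i j : ℂ) • lact (x N q k) (d (x N q l))
    + (((1 - ((ε : ℤ) : ℝ) * q) * (1 + q ^ (N - 2)) / (1 - ((ε : ℤ) : ℝ) * q ^ (N - 1)) : ℝ) : ℂ) •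
      ∑ k, ∑ l, (C N q k l : ℂ) •
        lact (x N q i * x N q j * x N q k) (d (x N q l)))

/-- The sub-bimodule of universal one-forms generated by the bimodule relations. -/
def relations (N : ℕ) (q : ℝ) (ε : ℤˣ) :
    Submodule (Sphere N q ⊗[ℂ] (Sphere N q)ᵐᵒᵖ) (UniversalForms (Sphere N q)) :=
  Submodule.span (Sphere N q ⊗[ℂ] (Sphere N q)ᵐᵒᵖ)
    (Set.range fun p : Fin N × Fin N =>
      bimoduleRelation N q ε (universalD (Sphere N q)) p.1 p.2)

/-- The bimodule of one-forms of `Γ₊` (`ε = 1`) or `Γ₋` (`ε = -1`): the first order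
differential calculus given by the bimodule relations. A calculus in which the `dx_i` form a
left module basis and satisfy these relations is necessarily isomorphic to it. -/
abbrev Forms (N : ℕ) (q : ℝ) (ε : ℤˣ) : Type :=
  UniversalForms (Sphere N q) ⧸ relations N q ε

/-- The differentiation map of `Γ₊` or `Γ₋`. -/
def d (N : ℕ) (q : ℝ) (ε : ℤˣ) : Sphere N q →ₗ[ℂ] Forms N q ε :=
  ((relations N q ε).mkQ.restrictScalars ℂ).comp (universalD (Sphere N q))

/-- The invariant one-form `C^{kl} x_k dx_l`. -/
def eta (N : ℕ) (q : ℝ) (ε : ℤˣ) : Forms N q ε :=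
  ∑ k, ∑ l, (C N q k l : ℂ) • lact (x N q k) (d N q ε (x N q l))

/-- `α⁺ = -(1 + q^{N-2}) / (1 - ε q^{N-1})`. -/
def alphaPlus (N : ℕ) (q : ℝ) (ε : ℤˣ) : ℝ :=
  -((1 + q ^ (N - 2)) / (1 - ((ε : ℤ) : ℝ) * q ^ (N - 1)))

/-- `α⁻ = ε q (1 + q^{N-2}) / (1 - ε q^{N-1})`. -/
def alphaMinus (N : ℕ) (q : ℝ) (ε : ℤˣ) : ℝ :=
  ((ε : ℤ) : ℝ) * q * ((1 + q ^ (N - 2)) / (1 - ((ε : ℤ) : ℝ) * q ^ (N - 1)))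

/-- `γ⁺_i = dx_i + α⁺ x_i C^{kl} x_k dx_l`. -/
def gammaPlus (N : ℕ) (q : ℝ) (ε : ℤˣ) (i : Fin N) : Forms N q ε :=
  d N q ε (x N q i) + (alphaPlus N q ε : ℂ) • lact (x N q i) (eta N q ε)

/-- `γ⁻_i = dx_i + α⁻ x_i C^{kl} x_k dx_l`. -/
def gammaMinus (N : ℕ) (q : ℝ) (ε : ℤˣ) (i : Fin N) : Forms N q ε :=
  d N q ε (x N q i) + (alphaMinus N q ε : ℂ) • lact (x N q i) (eta N q ε)

end QSphere

end

open scoped TensorProduct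

noncomputable section

namespace QSphere

/-! The flip `a ⊗ b ↦ b^* ⊗ a^*` is a conjugate linear ring endomorphism of the enveloping algebra,
and its negative maps universal one-forms to universal one-forms with `da ↦ d(a^*)`. Everything
reduces to showing that this map respects the bimodule relations; it then descends to `Γ_ε` as a map
semilinear over the flip. The `*`-calculus property follows by applying it to `∑ a_k db_k = 0`, and
it is the only involution because `∑ a_k db_k` exhausts the one-forms. No basis of `Γ_ε` is needed.

Up to the weights `q^{-ϱ}`, the star of the relation for `(i, j)` is the relation for `(j', i')`
with left and right multiplication exchanged and with `η` replaced by `-η`; the sign comes from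
differentiating `C^{kl} x_k x_l = 1`. The core is thus `lact_x_dx`: the exchanged relations follow
from the original ones. Substituting the original relations into the exchanged ones leaves four
scalar identities, once the following are known: the quadratic relation for `R⁻` (`sum_Rinv_Rinv`),
the eigenvector equation `R⁻ C = q^{N-1} C` (`sum_Rinv_C`), the sphere relations (`x_comm`), and the
rule `η x_j = x_j η + κ dx_j` (`ract_etaForm`), which rests on the crossing symmetry between `R⁻`
and `R` (`crossing`).

The same rule gives `(dx_i + a x_i η)^* = q^{-ϱ_i} ((1 - a κ) dx_{i'} - a x_{i'} η)`. The formulas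
for `γ^±` are then the identities `α⁺ κ = 1 - ε q⁻¹` and `α⁻ = -ε q α⁺`. -/

theorem wt_pos (N : ℕ) {q : ℝ} (hq : 0 < q) (i : Fin N) : 0 < wt N q i :=
  Real.rpow_pos_of_pos hq _

/-! ### Entries of `C` and `R⁻`; crossing symmetry -/

theorem C_eq (N : ℕ) (q : ℝ) (i j : Fin N) : C N q i j = if j = i.rev then wt N q i else 0 := by
  unfold C wt
  congr 1
  exact propext ⟨fun h => by rw [h, Fin.rev_rev], fun h => by rw [h, Fin.rev_rev]⟩

theorem C_rev (N : ℕ) (q : ℝ) (i : Fin N) : C N q i i.rev = wt N q i := by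
  rw [C_eq, if_pos rfl]

theorem C_rev_left (N : ℕ) (q : ℝ) (i : Fin N) : C N q i.rev i = wt N q i.rev := by
  rw [C_eq, if_pos (Fin.rev_rev i).symm]

theorem Rinv_eq (N : ℕ) (q : ℝ) (k l i j : Fin N) :
    Rinv N q k l i j =
      (if i = l ∧ j = k then
        q ^ ((if k = l then (1 : ℤ) else 0) - (if k = l.rev then (1 : ℤ) else 0)) else 0)
      + (if l ≤ i then (q - q⁻¹) * (K N q k l i j - I N k l i j) else 0) := by
  unfold Rinv R
  by_cases h : i < l
  · rw [if_pos h, if_neg (not_le.mpr h)]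
    ring
  · rw [if_neg h, if_pos (not_lt.mp h)]
    ring

/-- Bending one leg of `R⁻` with `C` turns it into `R`: the permutation supports correspond, while
the supports of `I` and `K` are interchanged. This is what makes `x_k (R⁻)^{mn}_{k'j} x_m dx_n`
accessible to the quadratic relations among the `x_i`. -/
theorem crossing (N : ℕ) {q : ℝ} (hq : 0 < q) (k m n j : Fin N) :
    wt N q k * Rinv N q m n k.rev j = wt N q n.rev * R N q k m j n.rev := by
  have hk := wt_rev_of_pos N hq k
  have hn := wt_rev_of_pos N hq n
  have hq0 := hq.ne'
  rw [Rinv_eq]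
  unfold R K I
  simp only [C_eq, Fin.rev_rev]
  -- The cases follow the supports: permutation part here; below, `h1` is the support of `K` on the
  -- left and of `I` on the right, and `h2` the reverse.
  by_cases hp : n = k.rev ∧ j = m
  · obtain ⟨rfl, rfl⟩ := hp
    simp only [Fin.rev_rev, and_true, le_refl, if_true, lt_irrefl, if_false]
    by_cases h1 : j = k <;> by_cases h2 : j = k.rev
    · subst h1
      simp only [← h2, if_true, and_true]
      rw [← h2] at hk
      simp [hk]
    · subst h1
      have h3 : ¬ j.rev = j := fun h => h2 h.symm
      simp only [h2, h3, if_true, if_false, zpow_neg, sub_zero, zero_sub, zpow_one, false_and]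
      linear_combination (q - q⁻¹) * wt N q j * hk
    · subst h2
      have h3 : ¬ k = k.rev := fun h => h1 h.symm
      simp [h3, h1]
    · have h3 : ¬ k.rev = j := fun h => h2 h.symm
      have h4 : ¬ k = j.rev := fun h => h2 (by rw [h, Fin.rev_rev])
      have h5 : ¬ k = j := fun h => h1 h.symm
      have h6 : ¬ k.rev = j.rev := fun h => h5 (Fin.rev_injective h)
      simp [h1, h2, h3, h4, h5, h6]
  · have hp1 : ¬ (k.rev = n ∧ j = m) := fun h => hp ⟨h.1.symm, h.2⟩
    have hp2 : ¬ (j = m ∧ n.rev = k) := fun h => hp ⟨by rw [← h.2, Fin.rev_rev], h.1⟩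
    rw [if_neg hp1, if_neg hp2]
    have hrev : k < n.rev ↔ n < k.rev := by
      rw [← Fin.rev_lt_rev, Fin.rev_rev]
    by_cases h1 : j = k ∧ m = n.rev
    · obtain ⟨rfl, rfl⟩ := h1
      have hne : n ≠ j.rev := fun h => hp ⟨h, by rw [h, Fin.rev_rev]⟩
      have hle : n ≤ j.rev ↔ n < j.rev := ⟨fun h => lt_of_le_of_ne h hne, le_of_lt⟩
      simp only [hle, hrev, Fin.rev_rev, Fin.rev_inj]
      by_cases h2 : j = n
      · subst h2
        split_ifs <;> first | ring1 | (simp_all <;> linear_combination (q - q⁻¹) * (wt N q j + wt N q j.rev) * hn)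
      · have h3 : ¬ n = j := fun h => h2 h.symm
        simp [h2, h3]
        split_ifs <;> first | ring1 | linear_combination (q - q⁻¹) * wt N q n.rev * hk
    · by_cases h2 : j = n ∧ m = k.rev
      · obtain ⟨rfl, rfl⟩ := h2
        have hne : j ≠ k.rev := fun h => hp ⟨h, h⟩
        have hle : j ≤ k.rev ↔ j < k.rev := ⟨fun h => lt_of_le_of_ne h hne, le_of_lt⟩
        have h3 : ¬ j = k := fun h => h1 ⟨h, by rw [h]⟩
        have h4 : ¬ k = j := fun h => h3 h.symm
        simp only [hle]
        simp [h3]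
        split_ifs <;> first | ring1 | linear_combination ((q - q⁻¹) * wt N q k) * hn
      · have a1 : ¬ (j = k ∧ n = m.rev) := fun h => h1 ⟨h.1, by rw [h.2, Fin.rev_rev]⟩
        have a2 : ¬ (k.rev = m ∧ j = n) := fun h => h2 ⟨h.2, h.1.symm⟩
        have a3 : ¬ (j = k ∧ n.rev = m) := fun h => h1 ⟨h.1, h.2.symm⟩
        have a4 : ¬ (n.rev = j.rev ∧ m = k.rev) := 
          fun h => h2 ⟨(Fin.rev_injective h.1).symm, h.2⟩
        rw [if_neg a2, if_neg a3]
        have z1 : ((if j = k then wt N q k.rev else 0) * if n = m.rev then wt N q m else 0) = 0 := by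
          by_cases b : j = k
          · rw [if_neg (fun h => a1 ⟨b, h⟩), mul_zero]
          · rw [if_neg b, zero_mul]
        have z2 : ((if n.rev = j.rev then wt N q j else 0) * if m = k.rev then wt N q k else 0)
            = 0 := by
          by_cases b : n.rev = j.rev
          · rw [if_neg (fun h => a4 ⟨b, h⟩), mul_zero]
          · rw [if_neg b, zero_mul]
        rw [z1, z2]
        simp

/-! ### Squared weights and their partial sums -/

/-- The exponents `ϱ_i` can be half-integers, so the weights are real powers; squaring makes the
exponents integral. -/
theorem wt_rev_sq_lt (N : ℕ) {q : ℝ} (hq : 0 < q) (i : Fin N) (h : 2 * (i : ℕ) + 1 < N) :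
    wt N q i.rev ^ 2 = q ^ ((N : ℤ) - 2 - 2 * (i : ℕ)) := by
  unfold wt
  rw [rho_rev, neg_neg, ← Real.rpow_natCast, ← Real.rpow_mul hq.le, ← Real.rpow_intCast]
  congr 1
  unfold rho
  rw [if_pos (by omega)]
  push_cast
  ring

theorem wt_rev_sq_eq (N : ℕ) {q : ℝ} (i : Fin N) (h : 2 * (i : ℕ) + 1 = N) :
    wt N q i.rev = 1 := by
  unfold wt
  rw [rho_rev, neg_neg]
  unfold rho
  rw [if_neg (by omega), if_pos (by omega), Real.rpow_zero]

theorem wt_rev_sq_gt (N : ℕ) {q : ℝ} (hq : 0 < q) (i : Fin N) (h : N < 2 * (i : ℕ) + 1) :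
    wt N q i.rev ^ 2 = q ^ ((N : ℤ) - 2 * (i : ℕ)) := by
  unfold wt
  rw [rho_rev, neg_neg, ← Real.rpow_natCast, ← Real.rpow_mul hq.le, ← Real.rpow_intCast]
  congr 1
  unfold rho
  rw [if_neg (by omega), if_neg (by omega)]
  push_cast
  ring

/-- The diagonal of the permutation part on pairs `(i, i')`. -/
def diagExp (N : ℕ) (i : Fin N) : ℤ := (if i = i.rev then (1 : ℤ) else 0) - 1

theorem eq_rev_iff (N : ℕ) (i : Fin N) : i = i.rev ↔ 2 * (i : ℕ) + 1 = N := by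
  rw [Fin.ext_iff, Fin.val_rev]; omega

theorem rev_le_iff (N : ℕ) (i : Fin N) : i.rev ≤ i ↔ N ≤ 2 * (i : ℕ) + 1 := by
  rw [Fin.le_def, Fin.val_rev]; omega

/-- Partial sums of the squared weights. -/
theorem sum_wt_sq (N : ℕ) {q : ℝ} (hq : 0 < q) (hN : 3 ≤ N) (i : Fin N) :
    (q - q⁻¹) * ∑ l, (if l ≤ i then wt N q l.rev ^ 2 else 0)
      = q ^ (N - 1) - q ^ diagExp N i * wt N q i.rev ^ 2 + if i.rev ≤ i then q - q⁻¹ else 0 := by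
  have hq0 := hq.ne'
  obtain ⟨n, hn⟩ := i
  induction n with
  | zero =>
    have h0 : ∀ l : Fin N, l ≤ ⟨0, hn⟩ ↔ l = ⟨0, hn⟩ := by
      intro l; rw [Fin.le_def, Fin.ext_iff]; simp
    simp only [h0, Finset.sum_ite_eq', Finset.mem_univ, if_true]
    rw [wt_rev_sq_lt N hq _ (by simp; omega), diagExp,
      if_neg (by rw [eq_rev_iff]; simp; omega), if_neg (by rw [Fin.ext_iff, Fin.val_rev]; simp; omega)]
    obtain ⟨m, rfl⟩ : ∃ m, N = m + 3 := ⟨N - 3, by omega⟩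
    have : (((m + 3 : ℕ) : ℤ) - 2 - 2 * ((⟨0, hn⟩ : Fin (m + 3)) : ℕ)) = ((m + 1 : ℕ) : ℤ) := by
      simp; ring
    rw [this, zpow_natCast]
    simp only [show m + 3 - 1 = m + 2 by omega]
    simp
    field_simp
    ring
  | succ n ih =>
    have hn' : n < N := by omega
    have key : ∑ l : Fin N, (if l ≤ ⟨n + 1, hn⟩ then wt N q l.rev ^ 2 else 0)
        = (∑ l : Fin N, (if l ≤ ⟨n, hn'⟩ then wt N q l.rev ^ 2 else 0))
          + wt N q (Fin.rev ⟨n + 1, hn⟩) ^ 2 := by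
      have : wt N q (Fin.rev ⟨n + 1, hn⟩) ^ 2
          = ∑ l : Fin N, if l = ⟨n + 1, hn⟩ then wt N q l.rev ^ 2 else 0 := by simp
      rw [this, ← Finset.sum_add_distrib]
      refine Finset.sum_congr rfl fun l _ => ?_
      simp only [Fin.le_def, Fin.ext_iff]
      split_ifs <;> first | omega | simp
    rw [key, mul_add, ih hn']
    simp only [diagExp, eq_rev_iff, rev_le_iff]
    -- The sum telescopes along powers of `q²`, except at the middle, where `ϱ` changes its formula;
    -- the terms with `diagExp` and `i.rev ≤ i` absorb the jump. Here the index `n + 1` lies before,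
    -- at, or after the middle.
    rcases lt_trichotomy (2 * (n + 1) + 1) N with h | h | h
    · rw [wt_rev_sq_lt N hq ⟨n, hn'⟩ (by simp; omega), wt_rev_sq_lt N hq ⟨n + 1, hn⟩ (by omega),
        if_neg (by omega), if_neg (by omega), if_neg (by omega),
        if_neg (by omega)]
      have : ((N : ℤ) - 2 - 2 * (n : ℕ)) = ((N : ℤ) - 2 - 2 * ((n + 1 : ℕ) : ℤ)) + 2 := by
        push_cast; ring
      simp only [this]
      rw [zpow_add₀ hq0]
      simp
      field_simp
      norm_cast
      ring
    · rw [wt_rev_sq_lt N hq ⟨n, hn'⟩ (by simp; omega), wt_rev_sq_eq N ⟨n + 1, hn⟩ (by omega),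
        if_neg (by omega), if_neg (by omega), if_pos (by omega),
        if_pos (by omega)]
      have : ((N : ℤ) - 2 - 2 * (n : ℕ)) = 1 := by omega
      simp only [this]
      simp
      field_simp
    -- For even `N` the step can jump over the middle, from `n` to its mirror image `n + 1`; for odd
    -- `N` it can leave the fixed point of the reversal.
    · rcases lt_trichotomy (2 * n + 1) N with h' | h' | h'
      · rw [wt_rev_sq_lt N hq ⟨n, hn'⟩ (by omega), wt_rev_sq_gt N hq ⟨n + 1, hn⟩ (by omega),
          if_neg (by omega), if_neg (by omega), if_neg (by omega),
          if_pos (by omega)]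
        have e1 : ((N : ℤ) - 2 - 2 * (n : ℕ)) = 0 := by omega
        have e2 : ((N : ℤ) - 2 * ((n + 1 : ℕ) : ℤ)) = 0 := by omega
        simp only [e1, e2]
        simp
      · rw [wt_rev_sq_eq N ⟨n, hn'⟩ (by omega), wt_rev_sq_gt N hq ⟨n + 1, hn⟩ (by omega),
          if_pos (by omega), if_pos (by omega), if_neg (by omega),
          if_pos (by omega)]
        have e2 : ((N : ℤ) - 2 * ((n + 1 : ℕ) : ℤ)) = -1 := by omega
        simp only [e2]
        simp
        field_simp
        ring
      · rw [wt_rev_sq_gt N hq ⟨n, hn'⟩ (by omega), wt_rev_sq_gt N hq ⟨n + 1, hn⟩ (by omega),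
          if_neg (by omega), if_pos (by omega), if_neg (by omega),
          if_pos (by omega)]
        have : ((N : ℤ) - 2 * (n : ℕ)) = ((N : ℤ) - 2 * ((n + 1 : ℕ) : ℤ)) + 2 := by
          push_cast; ring
        simp only [this]
        rw [zpow_add₀ hq0]
        simp
        field_simp
        norm_cast
        ring

/-! ### Block structure of `R⁻`, its eigenvector `C`, and the quadratic relation -/

theorem K_eq_zero_of_left (N : ℕ) (q : ℝ) {i j : Fin N} (h : j ≠ i.rev) (k l : Fin N) :
    K N q k l i j = 0 := by
  unfold K
  rw [C_eq N q i j, if_neg h, zero_mul]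

/-- Off the pairs `(i, i')` the matrix `K` drops out and only the entries at `(j, i)` and `(i, j)`
can survive, so every identity there is a computation on blocks of size at most two. -/
theorem Rinv_of_ne (N : ℕ) (q : ℝ) {i j : Fin N} (h : j ≠ i.rev) (k l : Fin N) :
    Rinv N q k l i j =
      (if k = j ∧ l = i then q ^ (if i = j then (1 : ℤ) else 0) else 0)
      - (if k = i ∧ l = j then (if j ≤ i then q - q⁻¹ else 0) else 0) := by
  have h' : j.rev ≠ i := fun e => h (by rw [← e, Fin.rev_rev])
  rw [Rinv_eq, K_eq_zero_of_left N q h]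
  unfold I
  by_cases h1 : k = j ∧ l = i
  · obtain ⟨rfl, rfl⟩ := h1
    by_cases h2 : k = l
    · subst h2; simp [h]
    · have h3 : ¬ l = k := fun e => h2 e.symm
      simp [h, h2, h3]
  · have h2 : ¬ (i = l ∧ j = k) := fun e => h1 ⟨e.2.symm, e.1.symm⟩
    rw [if_neg h1, if_neg h2]
    by_cases h3 : k = i ∧ l = j
    · obtain ⟨rfl, rfl⟩ := h3
      simp only [and_self, if_true, zero_sub, mul_neg, mul_one]
      split_ifs <;> simp
    · have h4 : ¬ (i = k ∧ j = l) := fun e => h3 ⟨e.1.symm, e.2.symm⟩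
      simp [h3, h4]

theorem Rinv_rev_of_ne (N : ℕ) (q : ℝ) {k l : Fin N} (h : l ≠ k.rev) (i : Fin N) :
    Rinv N q k l i i.rev = 0 := by
  have h1 : ¬ (i = l ∧ i.rev = k) := by
    rintro ⟨rfl, rfl⟩; exact h (Fin.rev_rev i).symm
  have h2 : ¬ (i = k ∧ i.rev = l) := by
    rintro ⟨rfl, rfl⟩; exact h rfl
  rw [Rinv_eq, if_neg h1]
  unfold K I
  rw [C_eq N q k l, if_neg h, if_neg h2]
  simp

/-- The block of `R⁻` on the span of the `e_i ⊗ e_{i'}`. -/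
theorem Rinv_rev_rev (N : ℕ) (q : ℝ) (i k : Fin N) :
    Rinv N q k k.rev i i.rev =
      (if k = i.rev then q ^ diagExp N i else 0)
      - (if k = i then (if i.rev ≤ i then q - q⁻¹ else 0) else 0)
      + (q - q⁻¹) * (wt N q i * (if k.rev ≤ i then wt N q k else 0)) := by
  rw [Rinv_eq]
  unfold K I
  rw [C_rev, C_rev]
  by_cases h1 : k = i.rev
  · subst h1
    by_cases h2 : i = i.rev
    · simp [diagExp, ← h2]; ring
    · have h3 : ¬ i.rev = i := fun e => h2 e.symm
      simp [diagExp, h2, h3]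
  · have h1' : ¬ (i = k.rev ∧ i.rev = k) := fun e => h1 e.2.symm
    rw [if_neg h1, if_neg h1']
    by_cases h2 : k = i
    · subst h2
      simp only [and_self, if_true]
      split_ifs <;> ring
    · have h3 : ¬ (i = k ∧ i.rev = k.rev) := fun e => h2 e.1.symm
      rw [if_neg h2, if_neg h3]
      split_ifs <;> ring

theorem sum_Rinv_of_ne (N : ℕ) (q : ℝ) {i j : Fin N} (h : j ≠ i.rev) (g : Fin N → Fin N → ℝ) :
    ∑ k, ∑ l, Rinv N q k l i j * g k l =
      q ^ (if i = j then (1 : ℤ) else 0) * g j i - (if j ≤ i then q - q⁻¹ else 0) * g i j := by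
  simp only [Rinv_of_ne N q h, sub_mul, Finset.sum_sub_distrib, ite_and, ite_mul, zero_mul,
    Finset.sum_ite_eq', Finset.mem_univ, if_true, Finset.sum_ite_irrel, Finset.sum_const_zero]

theorem sum_Rinv_rev (N : ℕ) (q : ℝ) (i : Fin N) (g : Fin N → Fin N → ℝ) :
    ∑ k, ∑ l, Rinv N q k l i i.rev * g k l =
      q ^ diagExp N i * g i.rev i - (if i.rev ≤ i then q - q⁻¹ else 0) * g i i.rev
      + (q - q⁻¹) * wt N q i * ∑ l, (if l ≤ i then wt N q l.rev * g l.rev l else 0) := by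
  have e1 : ∀ k : Fin N, ∑ l, Rinv N q k l i i.rev * g k l = Rinv N q k k.rev i i.rev * g k k.rev := by
    intro k
    rw [Finset.sum_eq_single k.rev]
    · intro l _ hl
      rw [Rinv_rev_of_ne N q hl, zero_mul]
    · simp
  simp only [e1, Rinv_rev_rev]
  generalize q - q⁻¹ = c
  simp only [add_mul, sub_mul, Finset.sum_add_distrib, Finset.sum_sub_distrib,
    ite_mul, zero_mul, Finset.sum_ite_eq', Finset.mem_univ, if_true, Fin.rev_rev]
  congr 1
  rw [Finset.mul_sum]
  refine Fintype.sum_equiv Fin.revPerm _ _ fun k => ?_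
  simp only [Fin.revPerm_apply, Fin.rev_rev]
  split_ifs <;> ring

/-- On the rows `(i, i')` this is `sum_wt_sq` multiplied by the weight of `i`; on all other rows
both sides vanish. -/
theorem sum_Rinv_C (N : ℕ) {q : ℝ} (hq : 0 < q) (hN : 3 ≤ N) (i j : Fin N) :
    ∑ k, ∑ l, Rinv N q k l i j * C N q k l = q ^ (N - 1) * C N q i j := by
  by_cases h : j = i.rev
  · subst h
    rw [sum_Rinv_rev]
    have hs := sum_wt_sq N hq hN i
    have hw := wt_rev_of_pos N hq i
    simp only [C_rev, C_rev_left, ← pow_two]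
    split_ifs at hs ⊢
    · linear_combination wt N q i * hs - q ^ diagExp N i * wt N q i.rev * hw
    · linear_combination wt N q i * hs - q ^ diagExp N i * wt N q i.rev * hw
  · have h' : ¬ i = j.rev := fun e => h (by rw [e, Fin.rev_rev])
    rw [sum_Rinv_of_ne N q h, C_eq, C_eq, if_neg h, if_neg h']
    ring

/-- Partial contraction of the diagonal block. -/
theorem sum_wt_Rinv (N : ℕ) {q : ℝ} (hq : 0 < q) (hN : 3 ≤ N) (i m : Fin N) :
    ∑ l, (if l ≤ i then wt N q l.rev * Rinv N q m m.rev l.rev l else 0)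
      = (if m ≤ i then q ^ diagExp N m * wt N q m.rev else 0)
        - (if m.rev ≤ i ∧ m.rev ≤ m then (q - q⁻¹) * wt N q m else 0)
        + wt N q m * (q ^ (N - 1) - q ^ diagExp N (min i m) * wt N q (min i m).rev ^ 2
            + if (min i m).rev ≤ min i m then q - q⁻¹ else 0) := by
  have e : ∀ l : Fin N, Rinv N q m m.rev l.rev l =
      (if l = m then q ^ diagExp N m else 0)
      - (if l = m.rev then (if m.rev ≤ m then q - q⁻¹ else 0) else 0)
      + (q - q⁻¹) * (wt N q l.rev * (if l ≤ m then wt N q m else 0)) := by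
    intro l
    have := Rinv_rev_rev N q l.rev m
    simp only [Fin.rev_rev] at this
    rw [this]
    congr 1
    · congr 1
      · by_cases h : l = m
        · subst h
          have : l.rev = l ↔ l = l.rev := eq_comm
          simp [diagExp, this]
        · have h' : ¬ m = l := fun e => h e.symm
          rw [if_neg h, if_neg h']
      · by_cases h : l = m.rev
        · subst h
          simp
        · have h' : ¬ m = l.rev := fun e => h (by rw [e, Fin.rev_rev])
          rw [if_neg h, if_neg h']
    · have : m.rev ≤ l.rev ↔ l ≤ m := Fin.rev_le_rev
      simp only [this]
  rw [← sum_wt_sq N hq hN (min i m)]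
  -- The two cutoffs `l ≤ i` (from the sum) and `l ≤ m` (from the `K` part of `R⁻`) combine to `l ≤
  -- min i m`, which leaves a partial sum already known from `sum_wt_sq`.
  have e2 : ∀ l : Fin N, (if l ≤ i then wt N q l.rev * Rinv N q m m.rev l.rev l else 0)
      = (if l = m then (if m ≤ i then q ^ diagExp N m * wt N q m.rev else 0) else 0)
        - (if l = m.rev then
            (if m.rev ≤ i ∧ m.rev ≤ m then (q - q⁻¹) * wt N q m else 0) else 0)
        + wt N q m * ((q - q⁻¹) * (if l ≤ min i m then wt N q l.rev ^ 2 else 0)) := by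
    intro l
    simp only [e, le_min_iff]
    by_cases hli : l ≤ i
    · simp only [hli, if_true, true_and]
      rw [mul_add, mul_sub]
      congr 1
      · congr 1
        · by_cases h : l = m
          · subst h; simp [hli, mul_comm]
          · simp [h]
        · by_cases h : l = m.rev
          · subst h; simp [hli, mul_comm]
          · simp [h]
      · split_ifs <;> ring
    · simp only [hli, if_false, false_and]
      have h1 : ¬ (l = m ∧ m ≤ i) := fun h => hli (h.1 ▸ h.2)
      have h2 : ¬ (l = m.rev ∧ (m.rev ≤ i ∧ m.rev ≤ m)) := fun h => hli (h.1 ▸ h.2.1)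
      rw [← ite_and, ← ite_and, if_neg h1, if_neg h2]
      ring
  simp only [e2, Finset.sum_add_distrib, Finset.sum_sub_distrib, Finset.sum_ite_eq',
    Finset.mem_univ, if_true, ← Finset.mul_sum]

theorem diagExp_rev (N : ℕ) (i : Fin N) : diagExp N i.rev = diagExp N i := by
  unfold diagExp
  rw [Fin.rev_rev]
  congr 2
  exact propext eq_comm

/-- The quadratic relation on the diagonal block. -/
theorem sum_Rinv_Rinv_rev (N : ℕ) {q : ℝ} (hq : 0 < q) (hN : 3 ≤ N) (i m : Fin N) :
    ∑ k, ∑ l, Rinv N q k l i i.rev * Rinv N q m m.rev k l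
      = I N m m.rev i i.rev - (q - q⁻¹) * Rinv N q m m.rev i i.rev
        + (q - q⁻¹) * q ^ (N - 1) * K N q m m.rev i i.rev := by
  have hq0 := hq.ne'
  rw [sum_Rinv_rev N q i (fun k l => Rinv N q m m.rev k l)]
  have hr := Rinv_rev_rev N q i.rev m
  rw [Fin.rev_rev, diagExp_rev] at hr
  rw [sum_wt_Rinv N hq hN, hr, Rinv_rev_rev]
  unfold K I
  rw [C_rev, C_rev]
  have hwi := wt_rev_of_pos N hq i
  have hwm := wt_rev_of_pos N hq m
  have hi0 := (wt_pos N hq i).ne'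
  have hm0 := (wt_pos N hq m).ne'
  have hri : wt N q i.rev = (wt N q i)⁻¹ := by field_simp; linarith
  have hrm : wt N q m.rev = (wt N q m)⁻¹ := by field_simp; linarith
  clear hr
  -- With all reversed weights written as inverses, the claim is checked at the entries `m = i` and
  -- `m = i'`, where the permutation and diagonal parts contribute, and then at the remaining
  -- entries, where only the position of `min i m` relative to the middle matters.
  by_cases h1 : m = i
  · subst h1
    rw [min_self]
    by_cases h2 : m = m.rev
    · have hw : wt N q m = 1 := by
        rw [h2]; exact wt_rev_sq_eq N m ((eq_rev_iff N m).mp h2)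
      have hd : diagExp N m = 0 := by simp [diagExp, ← h2]
      simp only [← h2, hw, hd]
      simp
    · have hd : diagExp N m = -1 := by simp [diagExp, h2]
      simp only [hri, h2, hd]
      rcases lt_or_gt_of_ne h2 with h | h
      · simp [h.not_ge]
        field_simp
        ring
      · simp [h.le]
        field_simp
        ring
  · by_cases h2 : m = i.rev
    · subst h2
      have h3 : ¬ i = i.rev := fun e => h1 e.symm
      have hd : diagExp N i = -1 := by simp [diagExp, h3]
      have hd' : diagExp N i.rev = -1 := by rw [diagExp_rev, hd]
      rcases lt_or_gt_of_ne h3 with h | h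
      · rw [min_eq_left h.le]
        simp [h.le, h.not_ge, hd, h1, h3, hri]
        field_simp
        ring
      · rw [min_eq_right h.le]
        simp [h.le, h.not_ge, hd, hd', h1, h3, hri]
        field_simp
        ring
    · have h3 : ¬ (i = m ∧ i.rev = m.rev) := fun h => h1 h.1.symm
      simp only [h1, h2, h3, if_false]
      rcases lt_or_gt_of_ne h1 with h | h
      · rw [min_eq_right h.le, hri, hrm]
        simp only [Fin.le_def, Fin.val_rev, Fin.lt_def, Fin.ext_iff] at *
        split_ifs <;> first | omega | (field_simp; ring1)
      · rw [min_eq_left h.le, hri, hrm]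
        simp only [Fin.le_def, Fin.val_rev, Fin.lt_def, Fin.ext_iff] at *
        split_ifs <;> first | omega | (field_simp; ring1)

/-- The quadratic relation `(R⁻)² = 1 - (q - q⁻¹) R⁻ + (q - q⁻¹) q^{N-1} K`. -/
theorem sum_Rinv_Rinv (N : ℕ) {q : ℝ} (hq : 0 < q) (hN : 3 ≤ N) (m n i j : Fin N) :
    ∑ k, ∑ l, Rinv N q k l i j * Rinv N q m n k l
      = I N m n i j - (q - q⁻¹) * Rinv N q m n i j
        + (q - q⁻¹) * q ^ (N - 1) * K N q m n i j := by
  have hq0 := hq.ne'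
  by_cases h : j = i.rev
  · subst h
    by_cases hn : n = m.rev
    · subst hn
      exact sum_Rinv_Rinv_rev N hq hN i m
    · have h1 : ¬ (i = m ∧ i.rev = n) := by
        rintro ⟨rfl, rfl⟩; exact hn rfl
      rw [Rinv_rev_of_ne N q hn]
      unfold I K
      rw [if_neg h1, C_eq N q m n, if_neg hn]
      simp only [mul_zero, sub_zero, add_zero]
      refine Finset.sum_eq_zero fun k _ => Finset.sum_eq_zero fun l _ => ?_
      by_cases hl : l = k.rev
      · subst hl
        rw [Rinv_rev_of_ne N q hn, mul_zero]
      · rw [Rinv_rev_of_ne N q hl, zero_mul]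
  · have h' : ¬ i = j.rev := fun e => h (by rw [e, Fin.rev_rev])
    rw [sum_Rinv_of_ne N q h (fun k l => Rinv N q m n k l), K_eq_zero_of_left N q h,
      Rinv_of_ne N q h', Rinv_of_ne N q h]
    unfold I
    by_cases hij : i = j
    · subst hij
      by_cases h1 : m = i ∧ n = i
      · obtain ⟨rfl, rfl⟩ := h1
        simp
        field_simp
      · have h2 : ¬ (i = m ∧ i = n) := fun e => h1 ⟨e.1.symm, e.2.symm⟩
        simp only [if_neg h1, if_neg h2]
        simp
    · have hji : ¬ j = i := fun e => hij e.symm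
      by_cases h1 : m = i ∧ n = j
      · obtain ⟨rfl, rfl⟩ := h1
        rcases lt_or_gt_of_ne hij with hlt | hlt
        · simp [hij, hji, hlt.not_ge]
        · simp [hij, hji, hlt.le]
      · have h2 : ¬ (i = m ∧ j = n) := fun e => h1 ⟨e.1.symm, e.2.symm⟩
        rw [if_neg h1, if_neg h2]
        by_cases h3 : m = j ∧ n = i
        · obtain ⟨rfl, rfl⟩ := h3
          rcases lt_or_gt_of_ne hij with hlt | hlt
          · simp [hij, hji, hlt.le, hlt.not_ge]
          · simp [hij, hji, hlt.le, hlt.not_ge]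
        · simp only [if_neg h3, if_neg h1]
          simp

/-! ### Bimodule calculus for `lact` and `ract` -/

section Bimodule

variable {A : Type*} [Ring A] [Algebra ℂ A]
  {M : Type*} [AddCommGroup M] [Module (A ⊗[ℂ] Aᵐᵒᵖ) M]

theorem lact_add (a : A) (ω η : M) : lact a (ω + η) = lact a ω + lact a η := smul_add _ _ _

theorem lact_zero (a : A) : lact a (0 : M) = 0 := smul_zero _

theorem lact_sum {ι : Type*} (s : Finset ι) (a : A) (f : ι → M) :
    lact a (∑ i ∈ s, f i) = ∑ i ∈ s, lact a (f i) := Finset.smul_sum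

theorem ract_add (ω η : M) (a : A) : ract (ω + η) a = ract ω a + ract η a := smul_add _ _ _

theorem ract_neg (ω : M) (a : A) : ract (-ω) a = -ract ω a := smul_neg _ _

theorem ract_sum {ι : Type*} (s : Finset ι) (a : A) (f : ι → M) :
    ract (∑ i ∈ s, f i) a = ∑ i ∈ s, ract (f i) a := Finset.smul_sum

theorem add_lact (a b : A) (ω : M) : lact (a + b) ω = lact a ω + lact b ω := by
  unfold lact; rw [TensorProduct.add_tmul, add_smul]

theorem sum_lact {ι : Type*} (s : Finset ι) (f : ι → A) (ω : M) :
    lact (∑ i ∈ s, f i) ω = ∑ i ∈ s, lact (f i) ω := by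
  unfold lact; rw [TensorProduct.sum_tmul, Finset.sum_smul]

theorem one_lact (ω : M) : lact (1 : A) ω = ω := by
  unfold lact; rw [← Algebra.TensorProduct.one_def, one_smul]

theorem ract_one (ω : M) : ract ω (1 : A) = ω := by
  unfold ract; rw [MulOpposite.op_one, ← Algebra.TensorProduct.one_def, one_smul]

theorem lact_lact (a b : A) (ω : M) : lact a (lact b ω) = lact (a * b) ω := by
  unfold lact; rw [smul_smul, Algebra.TensorProduct.tmul_mul_tmul, mul_one]

theorem ract_ract (ω : M) (a b : A) : ract (ract ω a) b = ract ω (a * b) := by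
  unfold ract; rw [smul_smul, Algebra.TensorProduct.tmul_mul_tmul, mul_one, MulOpposite.op_mul]

theorem ract_lact (a b : A) (ω : M) : ract (lact a ω) b = lact a (ract ω b) := by
  unfold ract lact
  rw [smul_smul, smul_smul, Algebra.TensorProduct.tmul_mul_tmul,
    Algebra.TensorProduct.tmul_mul_tmul]
  simp

theorem tmul_op_smul (a b : A) (ω : M) :
    (a ⊗ₜ[ℂ] MulOpposite.op b) • ω = lact a (ract ω b) := by
  unfold ract lact
  rw [smul_smul, Algebra.TensorProduct.tmul_mul_tmul]
  simp

variable [Module ℂ M] [IsScalarTower ℂ (A ⊗[ℂ] Aᵐᵒᵖ) M]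

theorem lact_smul (c : ℂ) (a : A) (ω : M) : lact a (c • ω) = c • lact a ω := by
  unfold lact
  rw [← algebraMap_smul (A ⊗[ℂ] Aᵐᵒᵖ) c ω, smul_smul, ← Algebra.commutes, mul_smul,
    algebraMap_smul]

theorem ract_smul (c : ℂ) (ω : M) (a : A) : ract (c • ω) a = c • ract ω a := by
  unfold ract
  rw [← algebraMap_smul (A ⊗[ℂ] Aᵐᵒᵖ) c ω, smul_smul, ← Algebra.commutes, mul_smul,
    algebraMap_smul]

theorem smul_lact (c : ℂ) (a : A) (ω : M) : lact (c • a) ω = c • lact a ω := by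
  unfold lact
  rw [← TensorProduct.smul_tmul', smul_assoc]

theorem smul_ract (c : ℂ) (ω : M) (a : A) : ract ω (c • a) = c • ract ω a := by
  unfold ract
  rw [MulOpposite.op_smul, TensorProduct.tmul_smul, smul_assoc]

end Bimodule

/-! ### The action of `R⁻` on vector-valued tensors -/

section Relations

variable (N : ℕ) (q : ℝ) (ε : ℤˣ)

/-- `R⁻` acting on tensors with entries in a complex vector space. -/
def rinvMap (M : Type*) [AddCommGroup M] [Module ℂ M] :
    (Fin N → Fin N → M) →ₗ[ℂ] (Fin N → Fin N → M) where
  toFun t i j := ∑ k, ∑ l, (Rinv N q k l i j : ℂ) • t k l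
  map_add' s t := by
    funext i j
    simp only [Pi.add_apply, smul_add, Finset.sum_add_distrib]
  map_smul' c t := by
    funext i j
    simp only [Pi.smul_apply, smul_comm _ c, Finset.smul_sum, RingHom.id_apply]

variable {N q ε}

theorem rinvMap_apply {M : Type*} [AddCommGroup M] [Module ℂ M] (t : Fin N → Fin N → M)
    (i j : Fin N) : rinvMap N q M t i j = ∑ k, ∑ l, (Rinv N q k l i j : ℂ) • t k l := rfl

theorem rinvMap_C {M : Type*} [AddCommGroup M] [Module ℂ M] (hq : 0 < q) (hN : 3 ≤ N) (m : M) :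
    rinvMap N q M (fun i j => (C N q i j : ℂ) • m)
      = ((q : ℂ) ^ (N - 1)) • fun i j => (C N q i j : ℂ) • m := by
  funext i j
  rw [rinvMap_apply, Pi.smul_apply, Pi.smul_apply, smul_smul]
  simp only [smul_smul, ← Finset.sum_smul]
  congr 1
  exact_mod_cast congrArg (fun r : ℝ => (r : ℂ)) (sum_Rinv_C N hq hN i j)

/-- `K` has rank one, so its term contributes only the `C`-trace of `t`; for `t k l = x_k dx_l` this
trace is `η`. -/
theorem rinvMap_rinvMap {M : Type*} [AddCommGroup M] [Module ℂ M] (hq : 0 < q) (hN : 3 ≤ N)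
    (t : Fin N → Fin N → M) (i j : Fin N) :
    rinvMap N q M (rinvMap N q M t) i j = t i j - ((q : ℂ) - (q : ℂ)⁻¹) • rinvMap N q M t i j
      + (((q : ℂ) - (q : ℂ)⁻¹) * (q : ℂ) ^ (N - 1) * C N q i j) •
        ∑ k, ∑ l, (C N q k l : ℂ) • t k l := by
  have hI : t i j = ∑ m, ∑ n, (I N m n i j : ℂ) • t m n := by
    rw [Finset.sum_eq_single i, Finset.sum_eq_single j]
    · simp [I]
    · intro b _ hb; simp [I, hb.symm]
    · simp
    · intro b _ hb; simp [I, hb.symm]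
    · simp
  rw [hI]
  simp only [rinvMap_apply, Finset.smul_sum, smul_smul]
  -- Bundling `(m, n)` into one index gives the inner sum a different type from the outer ones, so
  -- that exchanging sums by `simp` terminates.
  have e : ∀ k l : Fin N, ∑ m, ∑ n, ((Rinv N q k l i j : ℂ) * (Rinv N q m n k l : ℂ)) • t m n
      = ∑ p : Fin N × Fin N, ((Rinv N q k l i j : ℂ) * (Rinv N q p.1 p.2 k l : ℂ)) • t p.1 p.2 :=
    fun k l => (Fintype.sum_prod_type' _).symm
  simp only [e]
  simp only [Finset.sum_comm (s := (Finset.univ : Finset (Fin N))) (t := (Finset.univ : Finset (Fin N × Fin N)))]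
  rw [Fintype.sum_prod_type]
  rw [← Finset.sum_sub_distrib, ← Finset.sum_add_distrib]
  refine Finset.sum_congr rfl fun m _ => ?_
  rw [← Finset.sum_sub_distrib, ← Finset.sum_add_distrib]
  refine Finset.sum_congr rfl fun n _ => ?_
  rw [← sub_smul, ← add_smul]
  simp only [← Finset.sum_smul]
  congr 1
  have := congrArg (fun r : ℝ => (r : ℂ)) (sum_Rinv_Rinv N hq hN m n i j)
  simp only [K] at this
  push_cast at this ⊢
  rw [this]
  ring

end Relations

/-! ### Scalar identities among the coefficients -/

section Coefficients

variable (N : ℕ) (q : ℝ) (ε : ℤˣ)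

/-- The coefficient of `K` in the relations of the sphere. -/
def sphereCoeff : ℝ := (q ^ (N - 1) - q ^ (N - 3)) / (1 + q ^ (N - 2))

/-- The coefficient of `K` in the bimodule relations. -/
def traceCoeff : ℝ := (q ^ N - q ^ (N - 2)) / (1 - ((ε : ℤ) : ℝ) * q ^ (N - 1))

/-- The coefficient of the cubic term in the bimodule relations. -/
def cubicCoeff : ℝ :=
  (1 - ((ε : ℤ) : ℝ) * q) * (1 + q ^ (N - 2)) / (1 - ((ε : ℤ) : ℝ) * q ^ (N - 1))

/-- The factor in the commutation rule `η x_j = x_j η + κ dx_j`. -/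
def etaCoeff : ℝ := ((ε : ℤ) : ℝ) * (sphereCoeff N q + q⁻¹) - 1

variable {N q}

theorem sign_sq : (((ε : ℤ) : ℝ)) ^ 2 = 1 := by
  rcases Int.units_eq_one_or ε with rfl | rfl <;> simp

/-- The point where `q ≠ 1` enters: for `ε = 1` the denominator vanishes at `q = 1`, while for `ε =
-1` it is always positive. -/
theorem denom_ne_zero (hN : 3 ≤ N) (hq : 0 < q) (hq1 : q ≠ 1) :
    1 - ((ε : ℤ) : ℝ) * q ^ (N - 1) ≠ 0 := by
  have h0 : 0 < q ^ (N - 1) := pow_pos hq _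
  rcases Int.units_eq_one_or ε with rfl | rfl
  · intro h
    have h1 : q ^ (N - 1) = 1 := by simp at h; linarith
    exact hq1 ((pow_eq_one_iff_of_nonneg hq.le (by omega)).mp h1)
  · simp
    linarith

theorem one_add_pow_ne_zero (hq : 0 < q) : 1 + q ^ (N - 2) ≠ 0 := by
  have h0 : 0 < q ^ (N - 2) := pow_pos hq _
  linarith

theorem pow_shift (hN : 3 ≤ N) (hq : 0 < q) :
    q ^ N = q ^ 2 * q ^ (N - 2) ∧ q ^ (N - 1) = q * q ^ (N - 2) ∧
      q ^ (N - 3) = q⁻¹ * q ^ (N - 2) := by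
  obtain ⟨m, rfl⟩ : ∃ m, N = m + 3 := ⟨N - 3, by omega⟩
  have hq0 := hq.ne'
  simp only [Nat.add_sub_cancel, show m + 3 - 1 = m + 2 by omega, show m + 3 - 2 = m + 1 by omega]
  refine ⟨by ring, by ring, ?_⟩
  field_simp
  ring

/-- The left side is the coefficient of `x_j η` in `η x_j`; its value `1` gives the commutation rule
its simple form. -/
theorem trace_add_cubic (hN : 3 ≤ N) (hq : 0 < q) (hq1 : q ≠ 1) :
    traceCoeff N q ε + cubicCoeff N q ε + ((ε : ℤ) : ℝ) * q = 1 := by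
  have hd := denom_ne_zero ε hN hq hq1
  obtain ⟨h1, h2, h3⟩ := pow_shift hN hq
  have hs := sign_sq ε
  unfold traceCoeff cubicCoeff
  rw [h2] at hd
  rw [h1, h2]
  clear h1 h2 h3
  generalize ((ε : ℤ) : ℝ) = e at *
  generalize q ^ (N - 2) = p at *
  -- The denominator is kept as an atom while clearing fractions, and its value is fed back through
  -- `hD`.
  obtain ⟨D, hD⟩ : ∃ D, D = 1 - e * (q * p) := ⟨_, rfl⟩
  rw [← hD] at hd ⊢
  field_simp
  linear_combination (e * q - 1) * hD - p * q ^ 2 * hs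

/-- This factorisation lets `κ` cancel the quotient `(1 + q^{N-2}) / (1 - ε q^{N-1})` that appears
in `cubicCoeff` and in `α^±`. -/
theorem etaCoeff_eq (hN : 3 ≤ N) (hq : 0 < q) :
    etaCoeff N q ε * (1 + q ^ (N - 2))
      = -((1 - ((ε : ℤ) : ℝ) * q ^ (N - 1)) * (1 - ((ε : ℤ) : ℝ) * q⁻¹)) := by
  have hp := one_add_pow_ne_zero (N := N) hq
  obtain ⟨h1, h2, h3⟩ := pow_shift hN hq
  have hs := sign_sq ε
  have hq0 := hq.ne'
  unfold etaCoeff sphereCoeff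
  rw [h2, h3]
  generalize ((ε : ℤ) : ℝ) = e at *
  field_simp
  linear_combination (q ^ (N - 2) * q) * hs

theorem cubic_mul_etaCoeff (hN : 3 ≤ N) (hq : 0 < q) (hq1 : q ≠ 1) :
    cubicCoeff N q ε * etaCoeff N q ε = ((ε : ℤ) : ℝ) * q + ((ε : ℤ) : ℝ) * q⁻¹ - 2 := by
  have hd := denom_ne_zero ε hN hq hq1
  have hk := etaCoeff_eq ε hN hq
  have hs := sign_sq ε
  have hq0 := hq.ne'
  unfold cubicCoeff
  rw [div_mul_eq_mul_div, div_eq_iff hd]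
  generalize ((ε : ℤ) : ℝ) = e at *
  have hqq : q * q⁻¹ = 1 := mul_inv_cancel₀ hq0
  linear_combination (1 - e * q) * hk - (1 - e * q ^ (N - 1)) * q * q⁻¹ * hs
    - (1 - e * q ^ (N - 1)) * hqq

/-- Needed for the cancellation of the terms `C^{ij} η` in `lact_x_dx`. -/
theorem trace_cubic_sphere (hN : 3 ≤ N) (hq : 0 < q) (hq1 : q ≠ 1) :
    (q - q⁻¹) * q ^ (N - 1) + ((ε : ℤ) : ℝ) * traceCoeff N q ε * q ^ (N - 1)
      + ((ε : ℤ) : ℝ) * cubicCoeff N q ε * sphereCoeff N q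
      - ((ε : ℤ) : ℝ) * q⁻¹ * traceCoeff N q ε = 0 := by
  have hd := denom_ne_zero ε hN hq hq1
  have hp := one_add_pow_ne_zero (N := N) hq
  obtain ⟨h1, h2, h3⟩ := pow_shift hN hq
  have hs := sign_sq ε
  have hq0 := hq.ne'
  unfold traceCoeff cubicCoeff sphereCoeff
  rw [h2] at hd
  rw [h1, h2, h3]
  clear h1 h2 h3
  generalize ((ε : ℤ) : ℝ) = e at *
  generalize q ^ (N - 2) = p at *
  obtain ⟨D, hD⟩ : ∃ D, D = 1 - e * (q * p) := ⟨_, rfl⟩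
  rw [← hD] at hd ⊢
  field_simp
  linear_combination q * (q ^ 2 - 1) * p * (hD - hs)

theorem alphaMinus_eq : alphaMinus N q ε = -(((ε : ℤ) : ℝ) * q) * alphaPlus N q ε := by
  unfold alphaMinus alphaPlus
  ring

theorem alphaPlus_mul_etaCoeff (hN : 3 ≤ N) (hq : 0 < q) (hq1 : q ≠ 1) :
    alphaPlus N q ε * etaCoeff N q ε = 1 - ((ε : ℤ) : ℝ) * q⁻¹ := by
  have hd := denom_ne_zero ε hN hq hq1
  have hk := etaCoeff_eq ε hN hq
  unfold alphaPlus
  rw [← neg_div, div_mul_eq_mul_div, div_eq_iff hd]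
  linear_combination -hk

end Coefficients

/-! ### Relations of the sphere and of a calculus on it, in terms of `η` -/

section Calculus

variable {N : ℕ} {q : ℝ} {ε : ℤˣ}

theorem sum_C_smul {M : Type*} [AddCommGroup M] [Module ℂ M] (k : Fin N) (f : Fin N → M) :
    ∑ l, (C N q k l : ℂ) • f l = (wt N q k : ℂ) • f k.rev := by
  rw [Finset.sum_eq_single k.rev]
  · rw [C_rev]
  · intro l _ hl
    rw [C_eq, if_neg hl, Complex.ofReal_zero, zero_smul]
  · simp

theorem x_comm (i j : Fin N) :
    rinvMap N q (Sphere N q) (fun k l => x N q k * x N q l) i j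
      = (q : ℂ)⁻¹ • (x N q i * x N q j)
        + ((sphereCoeff N q : ℂ) * (C N q i j : ℂ)) • (1 : Sphere N q) := by
  have h1 := mk_rel N q (Rel.comm i j)
  have h2 := mk_rel N q (Rel.norm (N := N) (q := q))
  simp only [map_add, map_sum, map_smul, map_mul, map_one] at h1 h2
  rw [rinvMap_apply]
  refine h1.trans ?_
  rw [Complex.ofReal_inv]
  congr 1
  rw [← h2, mul_smul, Finset.smul_sum (r := (C N q i j : ℂ))]
  congr 1
  refine Finset.sum_congr rfl fun k _ => ?_
  rw [Finset.smul_sum]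
  refine Finset.sum_congr rfl fun l _ => ?_
  rw [smul_smul, K, Complex.ofReal_mul]

theorem x_norm : ∑ k, (wt N q k : ℂ) • (x N q k * x N q k.rev) = 1 := by
  have h2 := mk_rel N q (Rel.norm (N := N) (q := q))
  simp only [map_sum, map_smul, map_mul, map_one] at h2
  rw [← h2]
  refine Finset.sum_congr rfl fun k _ => ?_
  exact (sum_C_smul k (fun l => x N q k * x N q l)).symm

/-- Since `R = R⁻ + (q - q⁻¹)(I - K)`, the coefficient `q⁻¹` in `x_comm` becomes `q` and the
constant term is shifted by `-(q - q⁻¹)`. -/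
theorem sum_R_x (j p : Fin N) :
    ∑ k, ∑ m, (R N q k m j p : ℂ) • (x N q k * x N q m)
      = (q : ℂ) • (x N q j * x N q p)
        + (((sphereCoeff N q : ℂ) - ((q : ℂ) - (q : ℂ)⁻¹)) * (C N q j p : ℂ)) •
          (1 : Sphere N q) := by
  have hI : x N q j * x N q p = ∑ m, ∑ n, (I N m n j p : ℂ) • (x N q m * x N q n) := by
    rw [Finset.sum_eq_single j, Finset.sum_eq_single p]
    · simp [I]
    · intro b _ hb; simp [I, hb.symm]
    · simp
    · intro b _ hb; simp [I, hb.symm]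
    · simp
  have hK : (C N q j p : ℂ) • (1 : Sphere N q)
      = ∑ m, ∑ n, (K N q m n j p : ℂ) • (x N q m * x N q n) := by
    rw [← x_norm, Finset.smul_sum]
    refine Finset.sum_congr rfl fun k _ => ?_
    simp only [K, Complex.ofReal_mul, mul_smul]
    rw [← Finset.smul_sum, sum_C_smul k (fun l => x N q k * x N q l)]
  have hR : ∑ k, ∑ m, (R N q k m j p : ℂ) • (x N q k * x N q m)
      = rinvMap N q (Sphere N q) (fun k l => x N q k * x N q l) j p
        + ((q : ℂ) - (q : ℂ)⁻¹) • (x N q j * x N q p)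
        - ((q : ℂ) - (q : ℂ)⁻¹) • ((C N q j p : ℂ) • (1 : Sphere N q)) := by
    rw [hK, rinvMap_apply]
    conv_rhs => rw [hI]
    simp only [Finset.smul_sum, ← Finset.sum_add_distrib, ← Finset.sum_sub_distrib, smul_smul,
      ← add_smul, ← sub_smul]
    refine Finset.sum_congr rfl fun k _ => Finset.sum_congr rfl fun m _ => ?_
    congr 1
    unfold Rinv
    push_cast
    ring
  rw [hR, x_comm]
  module

variable {M : Type*} [AddCommGroup M] [Module (Sphere N q ⊗[ℂ] (Sphere N q)ᵐᵒᵖ) M] [Module ℂ M]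
  [IsScalarTower ℂ (Sphere N q ⊗[ℂ] (Sphere N q)ᵐᵒᵖ) M]

/-- The one-form `C^{kl} x_k dx_l` of a calculus on the sphere. -/
def etaForm (δ : Sphere N q →ₗ[ℂ] M) : M :=
  ∑ k, (wt N q k : ℂ) • lact (x N q k) (δ (x N q k.rev))

theorem ract_dx_x {δ : Sphere N q →ₗ[ℂ] M} (i j : Fin N)
    (h : bimoduleRelation N q ε δ i j = 0) :
    ract (δ (x N q i)) (x N q j)
      = (((ε : ℤ) : ℝ) : ℂ) • rinvMap N q M (fun k l => lact (x N q k) (δ (x N q l))) i j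
        + ((((ε : ℤ) : ℝ) : ℂ) * q - 1) • lact (x N q i) (δ (x N q j))
        + ((traceCoeff N q ε : ℂ) * C N q i j) • etaForm δ
        + (cubicCoeff N q ε : ℂ) • lact (x N q i * x N q j) (etaForm δ) := by
  unfold bimoduleRelation at h
  rw [sub_eq_zero] at h
  rw [h]
  refine congrArg₂ (· + ·) (congrArg₂ (· + ·) (congrArg₂ (· + ·) rfl ?_) ?_) ?_
  · push_cast; rfl
  · rw [mul_smul]
    refine congrArg₂ (· • ·) rfl ?_
    rw [etaForm, Finset.smul_sum]
    refine Finset.sum_congr rfl fun k _ => ?_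
    simp only [K, Complex.ofReal_mul, mul_smul]
    rw [← Finset.smul_sum, sum_C_smul k (fun l => lact (x N q k) (δ (x N q l)))]
  · refine congrArg₂ (· • ·) rfl ?_
    rw [etaForm, lact_sum]
    refine Finset.sum_congr rfl fun k _ => ?_
    rw [sum_C_smul k (fun l => lact (x N q i * x N q j * x N q k) (δ (x N q l))), lact_smul,
      lact_lact]

end Calculus

/-! ### The invariant form `η` and the exchanged bimodule relations -/

section Calculus

variable {N : ℕ} {q : ℝ} {ε : ℤˣ}
variable {M : Type*} [AddCommGroup M] [Module (Sphere N q ⊗[ℂ] (Sphere N q)ᵐᵒᵖ) M] [Module ℂ M]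

/-- Leibniz applied to `1 = C^{kl} x_k x_l`, together with `d1 = 0`. This is the origin of `η^* =
-η`. -/
theorem sum_ract_dx_x {δ : Sphere N q →ₗ[ℂ] M}
    (hδ : ∀ a b, δ (a * b) = ract (δ a) b + lact a (δ b)) :
    ∑ k, (wt N q k : ℂ) • ract (δ (x N q k)) (x N q k.rev) = -etaForm δ := by
  have h1 : δ 1 = 0 := by
    have := hδ 1 1
    rw [mul_one, ract_one, one_lact] at this
    simpa using this
  rw [← x_norm, map_sum] at h1
  simp only [map_smul, hδ, smul_add, Finset.sum_add_distrib] at h1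
  exact eq_neg_of_add_eq_zero_left h1

variable [IsScalarTower ℂ (Sphere N q ⊗[ℂ] (Sphere N q)ᵐᵒᵖ) M]

/-- After `crossing`, the matrix acts on the product of the two coordinates to the left of `dx_n`,
where the quadratic relation `sum_R_x` applies; its constant term collapses to a multiple of `dx_j`.
-/
theorem sum_wt_rinvMap_lact (hq : 0 < q) (δ : Sphere N q →ₗ[ℂ] M) (j : Fin N) :
    ∑ k, (wt N q k : ℂ) • lact (x N q k)
        (rinvMap N q M (fun k l => lact (x N q k) (δ (x N q l))) k.rev j)
      = (q : ℂ) • lact (x N q j) (etaForm δ)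
        + ((sphereCoeff N q : ℂ) - ((q : ℂ) - (q : ℂ)⁻¹)) • δ (x N q j) := by
  have e1 : ∀ k : Fin N, (wt N q k : ℂ) • lact (x N q k)
      (rinvMap N q M (fun k l => lact (x N q k) (δ (x N q l))) k.rev j)
      = ∑ m, ∑ n, ((wt N q n.rev : ℂ) * (R N q k m j n.rev : ℂ)) •
          lact (x N q k * x N q m) (δ (x N q n)) := by
    intro k
    simp only [rinvMap_apply, lact_sum, Finset.smul_sum, lact_smul, smul_smul, lact_lact]
    refine Finset.sum_congr rfl fun m _ => Finset.sum_congr rfl fun n _ => ?_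
    rw [← Complex.ofReal_mul, crossing N hq, Complex.ofReal_mul]
  have e2 : ∀ n : Fin N, ∑ k, ∑ m, ((wt N q n.rev : ℂ) * (R N q k m j n.rev : ℂ)) •
          lact (x N q k * x N q m) (δ (x N q n))
      = (wt N q n.rev : ℂ) • lact (∑ k, ∑ m, (R N q k m j n.rev : ℂ) • (x N q k * x N q m))
          (δ (x N q n)) := by
    intro n
    simp only [sum_lact, smul_lact, Finset.smul_sum, smul_smul]
  have e3 : ∑ k, ∑ m, ∑ n, ((wt N q n.rev : ℂ) * (R N q k m j n.rev : ℂ)) •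
          lact (x N q k * x N q m) (δ (x N q n))
      = ∑ n, ∑ k, ∑ m, ((wt N q n.rev : ℂ) * (R N q k m j n.rev : ℂ)) •
          lact (x N q k * x N q m) (δ (x N q n)) := by
    rw [Finset.sum_comm]
    conv_lhs => enter [2, m]; rw [Finset.sum_comm]
    rw [Finset.sum_comm]
    refine Finset.sum_congr rfl fun n _ => Finset.sum_comm
  simp only [e1]
  rw [e3]
  simp only [e2, sum_R_x, add_lact, smul_lact, one_lact, smul_add, Finset.sum_add_distrib]
  congr 1
  · rw [etaForm, lact_sum, Finset.smul_sum]
    refine Fintype.sum_equiv Fin.revPerm _ _ fun n => ?_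
    rw [Fin.revPerm_apply, Fin.rev_rev, lact_smul, lact_lact, smul_comm]
  · rw [Finset.sum_eq_single j]
    · rw [C_rev, smul_smul]
      congr 1
      have := congrArg (fun r : ℝ => (r : ℂ)) (wt_rev_of_pos N hq j)
      push_cast at this
      linear_combination ((sphereCoeff N q : ℂ) - ((q : ℂ) - (q : ℂ)⁻¹)) * this
    · intro n _ hn
      rw [C_eq, if_neg (fun h => hn (Fin.rev_injective h))]
      simp
    · simp

/-- The commutation rule of the invariant one-form with the generators. -/
theorem ract_etaForm (hN : 3 ≤ N) (hq : 0 < q) (hq1 : q ≠ 1) {δ : Sphere N q →ₗ[ℂ] M}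
    (h : ∀ i j, bimoduleRelation N q ε δ i j = 0) (j : Fin N) :
    ract (etaForm δ) (x N q j)
      = lact (x N q j) (etaForm δ) + (etaCoeff N q ε : ℂ) • δ (x N q j) := by
  have hsum : ract (etaForm δ) (x N q j)
      = ∑ k, (wt N q k : ℂ) • lact (x N q k) (ract (δ (x N q k.rev)) (x N q j)) := by
    conv_lhs => rw [etaForm, ract_sum]
    simp only [ract_smul, ract_lact]
  have t1 := sum_wt_rinvMap_lact hq δ j
  -- Contracting the remaining terms of the bimodule relation: `t2` is the sphere equation, `t3` the
  -- fact that the weights of `j` and `j'` are inverse.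
  have t2 : ∀ ω : M, ∑ k, (wt N q k : ℂ) • lact (x N q k) (lact (x N q k.rev) ω) = ω := by
    intro ω
    simp only [lact_lact, ← smul_lact]
    rw [← sum_lact, x_norm, one_lact]
  have t3 : ∑ k, (wt N q k : ℂ) • lact (x N q k) ((C N q k.rev j : ℂ) • etaForm δ)
      = lact (x N q j) (etaForm δ) := by
    rw [Finset.sum_eq_single j]
    · rw [C_rev_left, lact_smul, smul_smul, ← Complex.ofReal_mul, wt_rev_of_pos N hq,
        Complex.ofReal_one, one_smul]
    · intro k _ hk
      rw [C_eq, Fin.rev_rev, if_neg (Ne.symm hk), Complex.ofReal_zero, zero_smul, lact_zero,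
        smul_zero]
    · simp
  have expand : ∀ k : Fin N,
      (wt N q k : ℂ) • lact (x N q k) (ract (δ (x N q k.rev)) (x N q j))
      = (((ε : ℤ) : ℝ) : ℂ) • ((wt N q k : ℂ) • lact (x N q k)
            (rinvMap N q M (fun k l => lact (x N q k) (δ (x N q l))) k.rev j))
        + ((((ε : ℤ) : ℝ) : ℂ) * q - 1) •
            ((wt N q k : ℂ) • lact (x N q k) (lact (x N q k.rev) (δ (x N q j))))
        + (traceCoeff N q ε : ℂ) •
            ((wt N q k : ℂ) • lact (x N q k) ((C N q k.rev j : ℂ) • etaForm δ))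
        + (cubicCoeff N q ε : ℂ) •
            ((wt N q k : ℂ) • lact (x N q k) (lact (x N q k.rev)
              (lact (x N q j) (etaForm δ)))) := by
    intro k
    rw [ract_dx_x k.rev j (h k.rev j)]
    simp only [lact_add, lact_smul, lact_lact]
    module
  rw [hsum]
  simp only [expand, Finset.sum_add_distrib]
  simp only [← Finset.smul_sum, t1, t2, t3]
  have c1 := congrArg (fun r : ℝ => (r : ℂ)) (trace_add_cubic ε hN hq hq1)
  push_cast at c1
  unfold etaCoeff
  push_cast
  match_scalars
  · linear_combination c1
  · ring

/-- The bimodule relations with left and right multiplication exchanged. -/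
theorem lact_x_dx (hN : 3 ≤ N) (hq : 0 < q) (hq1 : q ≠ 1) {δ : Sphere N q →ₗ[ℂ] M}
    (h : ∀ i j, bimoduleRelation N q ε δ i j = 0) (i j : Fin N) :
    lact (x N q i) (δ (x N q j))
      = (((ε : ℤ) : ℝ) : ℂ) • rinvMap N q M (fun k l => ract (δ (x N q k)) (x N q l)) i j
        + ((((ε : ℤ) : ℝ) : ℂ) * q - 1) • ract (δ (x N q i)) (x N q j)
        - ((traceCoeff N q ε : ℂ) * C N q i j) • etaForm δ
        - (cubicCoeff N q ε : ℂ) • ract (etaForm δ) (x N q i * x N q j) := by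
  -- Moving `η` past two generators produces exactly the two mixed forms `x_i dx_j` and `dx_i x_j`.
  have hη : ract (etaForm δ) (x N q i * x N q j)
      = lact (x N q i * x N q j) (etaForm δ)
        + (etaCoeff N q ε : ℂ) • (lact (x N q i) (δ (x N q j)) + ract (δ (x N q i)) (x N q j)) := by
    rw [← ract_ract, ract_etaForm hN hq hq1 h, ract_add, ract_lact, ract_etaForm hN hq hq1 h,
      lact_add, lact_lact, ract_smul, lact_smul]
    module
  have hD : (fun k l => ract (δ (x N q k)) (x N q l))
      = (((ε : ℤ) : ℝ) : ℂ) • rinvMap N q M (fun k l => lact (x N q k) (δ (x N q l)))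
        + ((((ε : ℤ) : ℝ) : ℂ) * q - 1) • (fun k l => lact (x N q k) (δ (x N q l)))
        + (traceCoeff N q ε : ℂ) • (fun k l => (C N q k l : ℂ) • etaForm δ)
        + (cubicCoeff N q ε : ℂ) • (fun k l => lact (x N q k * x N q l) (etaForm δ)) := by
    funext k l
    rw [ract_dx_x k l (h k l)]
    simp only [Pi.add_apply, Pi.smul_apply, smul_smul]
  have hxx : rinvMap N q M (fun k l => lact (x N q k * x N q l) (etaForm δ)) i j
      = (q : ℂ)⁻¹ • lact (x N q i * x N q j) (etaForm δ)
        + ((sphereCoeff N q : ℂ) * (C N q i j : ℂ)) • etaForm δ := by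
    have := congrArg (fun a => lact a (etaForm δ)) (x_comm (N := N) (q := q) i j)
    simp only [rinvMap_apply, sum_lact, smul_lact, add_lact, one_lact] at this
    rw [rinvMap_apply, this]
  have hQQ := rinvMap_rinvMap hq hN (fun k l => lact (x N q k) (δ (x N q l))) i j
  have hη' : ∑ k, ∑ l, (C N q k l : ℂ) • lact (x N q k) (δ (x N q l)) = etaForm δ := by
    rw [etaForm]
    exact Finset.sum_congr rfl fun k _ => sum_C_smul k (fun l => lact (x N q k) (δ (x N q l)))
  rw [hη'] at hQQ
  have hC := congrFun (congrFun (rinvMap_C hq hN (etaForm δ)) i) j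
  rw [Pi.smul_apply, Pi.smul_apply] at hC
  have hQD : rinvMap N q M (fun k l => ract (δ (x N q k)) (x N q l)) i j = _ :=
    congrFun (congrFun (congrArg (rinvMap N q M) hD) i) j
  simp only [map_add, map_smul, Pi.add_apply, Pi.smul_apply] at hQD
  rw [hQD, hQQ, hC, hxx, hη, ract_dx_x i j (h i j)]
  have k1 := congrArg (fun r : ℝ => (r : ℂ)) (cubic_mul_etaCoeff ε hN hq hq1)
  have k2 := congrArg (fun r : ℝ => (r : ℂ)) (trace_cubic_sphere ε hN hq hq1)
  have k3 := congrArg (fun r : ℝ => (r : ℂ)) (sign_sq ε)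
  have k4 : (q : ℂ) * (q : ℂ)⁻¹ = 1 := mul_inv_cancel₀ (by exact_mod_cast hq.ne')
  push_cast at k1 k2 k3
  push_cast
  generalize lact (x N q i) (δ (x N q j)) = E
  generalize rinvMap N q M (fun k l => lact (x N q k) (δ (x N q l))) i j = Q
  generalize lact (x N q i * x N q j) (etaForm δ) = X
  generalize etaForm δ = η
  generalize (((ε : ℤ) : ℂ)) = e at *
  generalize (traceCoeff N q ε : ℂ) = c1 at *
  generalize (cubicCoeff N q ε : ℂ) = c2 at *
  generalize (etaCoeff N q ε : ℂ) = κ at *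
  generalize (sphereCoeff N q : ℂ) = c0 at *
  generalize (C N q i j : ℂ) = c at *
  generalize (q : ℂ) ^ (N - 1) = p at *
  generalize (q : ℂ)⁻¹ = r at *
  generalize (q : ℂ) = q at *
  -- The coefficients of `x_i dx_j`, of its image under `R⁻`, of `η` and of `x_i x_j η`. The product
  -- `c2 * κ` settles all of them, with `k2` needed in addition for `η`.
  match_scalars
  · linear_combination e * q * k1 + e ^ 2 * k4
  · linear_combination e * k1
  · linear_combination c * c1 * k1 - c * k2 - c * (q - r) * p * k3
  · linear_combination c2 * k1

end Calculus

/-! ### The universal calculus and its involution -/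

section Universal

variable {A : Type*} [Ring A] [Algebra ℂ A]

theorem universalD_mul (a b : A) :
    universalD A (a * b) = ract (universalD A a) b + lact a (universalD A b) := by
  apply Subtype.ext
  simp only [universalD, ract, lact, LinearMap.coe_mk, AddHom.coe_mk, Submodule.coe_add,
    Submodule.coe_smul, smul_eq_mul, mul_sub, Algebra.TensorProduct.tmul_mul_tmul, one_mul, mul_one,
    ← MulOpposite.op_mul]
  abel

theorem exists_sum_iff_mem_closure {M : Type*} [AddCommGroup M] [Module (A ⊗[ℂ] Aᵐᵒᵖ) M]
    [Module ℂ M] (δ : A →ₗ[ℂ] M) {ω : M}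
    (h : ω ∈ AddSubmonoid.closure (Set.range fun p : A × A => lact p.1 (δ p.2))) :
    ∃ (n : ℕ) (a b : Fin n → A), ω = ∑ k, lact (a k) (δ (b k)) := by
  induction h using AddSubmonoid.closure_induction with
  | mem ω h =>
    obtain ⟨p, rfl⟩ := h
    exact ⟨1, fun _ => p.1, fun _ => p.2, by simp⟩
  | zero => exact ⟨0, Fin.elim0, Fin.elim0, by simp⟩
  | add ω η _ _ hω hη =>
    obtain ⟨n, a, b, rfl⟩ := hω
    obtain ⟨m, c, e, rfl⟩ := hη
    exact ⟨n + m, Fin.append a c, Fin.append b e, by simp [Fin.sum_univ_add]⟩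

/-- Right multiplication is absorbed by Leibniz: `(a db) e = a d(be) - ab de`. Hence the sums of
forms `a db` are a sub-bimodule. -/
theorem smul_mem_closure {M : Type*} [AddCommGroup M] [Module (A ⊗[ℂ] Aᵐᵒᵖ) M]
    [Module ℂ M] {δ : A →ₗ[ℂ] M} (hδ : ∀ a b, δ (a * b) = ract (δ a) b + lact a (δ b))
    (r : A ⊗[ℂ] Aᵐᵒᵖ) {ω : M}
    (h : ω ∈ AddSubmonoid.closure (Set.range fun p : A × A => lact p.1 (δ p.2))) :
    r • ω ∈ AddSubmonoid.closure (Set.range fun p : A × A => lact p.1 (δ p.2)) := by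
  induction r with
  | zero =>
    convert AddSubmonoid.zero_mem _
    exact zero_smul (A ⊗[ℂ] Aᵐᵒᵖ) ω
  | add r s hr hs => rw [add_smul]; exact add_mem hr hs
  | tmul c e =>
    obtain ⟨e, rfl⟩ := MulOpposite.op_surjective e
    induction h using AddSubmonoid.closure_induction with
    | mem ω h =>
      obtain ⟨p, rfl⟩ := h
      have e1 : (c ⊗ₜ[ℂ] MulOpposite.op e) • lact p.1 (δ p.2)
          = lact (c * p.1) (δ (p.2 * e)) + lact (-(c * p.1 * p.2)) (δ e) := by
        have hn : lact (-(c * p.1 * p.2)) (δ e) = - lact (c * p.1 * p.2) (δ e) := by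
          unfold lact; rw [TensorProduct.neg_tmul, neg_smul]
        rw [tmul_op_smul, ract_lact, lact_lact, hδ, lact_add, lact_lact, hn]
        abel
      simp only [e1]
      exact add_mem (AddSubmonoid.subset_closure ⟨(_, _), rfl⟩)
        (AddSubmonoid.subset_closure ⟨(_, _), rfl⟩)
    | zero => rw [smul_zero]; exact zero_mem _
    | add ω η _ _ hω hη => rw [smul_add]; exact add_mem hω hη

theorem universalForms_mem_closure (ω : UniversalForms A) :
    ω ∈ AddSubmonoid.closure
      (Set.range fun p : A × A => lact p.1 (universalD A p.2)) := by
  obtain ⟨ω, hω⟩ := ω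
  induction hω using Submodule.span_induction with
  | mem ω h =>
    obtain ⟨a, rfl⟩ := h
    exact AddSubmonoid.subset_closure ⟨(1, a), one_lact _⟩
  | zero => exact zero_mem _
  | add ω η _ _ hω hη => exact add_mem hω hη
  | smul r ω _ hω => exact smul_mem_closure universalD_mul r hω

variable [StarRing A] [StarModule ℂ A]

/-- The conjugate linear ring automorphism `a ⊗ b ↦ b^* ⊗ a^*` of the enveloping algebra. -/
def envStarAdd (A : Type*) [Ring A] [Algebra ℂ A] [StarRing A] [StarModule ℂ A] :
    A ⊗[ℂ] Aᵐᵒᵖ →+ A ⊗[ℂ] Aᵐᵒᵖ :=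
  TensorProduct.liftAddHom
    { toFun := fun a =>
        { toFun := fun b => star b.unop ⊗ₜ[ℂ] MulOpposite.op (star a)
          map_zero' := by simp
          map_add' := fun b c => by simp [TensorProduct.add_tmul] }
      map_zero' := by ext; simp
      map_add' := fun a b => by ext; simp [TensorProduct.tmul_add] }
    (fun c a b => by
      simp only [AddMonoidHom.coe_mk, ZeroHom.coe_mk, star_smul, MulOpposite.unop_smul,
        MulOpposite.op_smul, TensorProduct.tmul_smul, ← TensorProduct.smul_tmul'])

@[simp]
theorem envStarAdd_tmul (a b : A) :
    envStarAdd A (a ⊗ₜ[ℂ] MulOpposite.op b) = star b ⊗ₜ[ℂ] MulOpposite.op (star a) := rfl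

/-- The ring homomorphism `a ⊗ b ↦ b^* ⊗ a^*` of the enveloping algebra. -/
def envStar (A : Type*) [Ring A] [Algebra ℂ A] [StarRing A] [StarModule ℂ A] :
    A ⊗[ℂ] Aᵐᵒᵖ →+* A ⊗[ℂ] Aᵐᵒᵖ :=
  { envStarAdd A with
    map_one' := by
      change envStarAdd A (1 ⊗ₜ[ℂ] MulOpposite.op 1) = 1
      rw [envStarAdd_tmul]
      simp [Algebra.TensorProduct.one_def]
    map_mul' := fun r s => by
      change envStarAdd A (r * s) = envStarAdd A r * envStarAdd A s
      induction r with
      | zero => simp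
      | add r r' hr hr' => simp only [add_mul, map_add, hr, hr']
      | tmul a b =>
        induction s with
        | zero => simp
        | add s s' hs hs' => simp only [mul_add, map_add, hs, hs']
        | tmul c e =>
          obtain ⟨b, rfl⟩ := MulOpposite.op_surjective b
          obtain ⟨e, rfl⟩ := MulOpposite.op_surjective e
          simp only [Algebra.TensorProduct.tmul_mul_tmul, ← MulOpposite.op_mul, envStarAdd_tmul,
            star_mul] }

theorem envStar_tmul (a b : A) :
    envStar A (a ⊗ₜ[ℂ] MulOpposite.op b) = star b ⊗ₜ[ℂ] MulOpposite.op (star a) := rfl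

/-- The flip sends `1 ⊗ a - a ⊗ 1` to `a^* ⊗ 1 - 1 ⊗ a^*`; the sign turns this into the universal
differential of `a^*`. -/
theorem envStar_mem (ω : A ⊗[ℂ] Aᵐᵒᵖ) (h : ω ∈ UniversalForms A) :
    -envStar A ω ∈ UniversalForms A := by
  induction h using Submodule.span_induction with
  | mem ω h =>
    obtain ⟨a, rfl⟩ := h
    refine Submodule.subset_span ⟨star a, ?_⟩
    rw [map_sub, ← MulOpposite.op_one, envStar_tmul, envStar_tmul]
    simp
  | zero => simp
  | add ω η _ _ hω hη => rw [map_add, neg_add]; exact add_mem hω hη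
  | smul r ω _ hω =>
    have e : -envStar A (r • ω) = envStar A r • -envStar A ω := by
      rw [smul_eq_mul, map_mul]
      exact (mul_neg (envStar A r) (envStar A ω)).symm
    rw [e]
    exact Submodule.smul_mem _ _ hω

/-- The involution of the universal calculus, semilinear over `a ⊗ b ↦ b^* ⊗ a^*`. -/
def universalStar (A : Type*) [Ring A] [Algebra ℂ A] [StarRing A] [StarModule ℂ A] :
    UniversalForms A →ₛₗ[envStar A] UniversalForms A where
  toFun ω := ⟨-envStar A ω.1, envStar_mem ω.1 ω.2⟩
  map_add' ω η := by
    apply Subtype.ext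
    simp only [Submodule.coe_add, map_add, neg_add]
  map_smul' r ω := by
    apply Subtype.ext
    simp only [Submodule.coe_smul, smul_eq_mul, map_mul]
    exact (mul_neg (envStar A r) (envStar A ω.1)).symm

theorem universalStar_universalD (a : A) :
    universalStar A (universalD A a) = universalD A (star a) := by
  apply Subtype.ext
  change -envStar A ((1 : A) ⊗ₜ[ℂ] MulOpposite.op a - a ⊗ₜ[ℂ] MulOpposite.op (1 : A)) = _
  rw [map_sub, envStar_tmul, envStar_tmul]
  simp [universalD]

section Semilinear

variable {M M' : Type*} [AddCommGroup M] [AddCommGroup M'] [Module (A ⊗[ℂ] Aᵐᵒᵖ) M]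
  [Module (A ⊗[ℂ] Aᵐᵒᵖ) M'] (s : M →ₛₗ[envStar A] M')

theorem semilinear_lact (a : A) (ω : M) : s (lact a ω) = ract (s ω) (star a) := by
  unfold lact ract
  rw [← MulOpposite.op_one, s.map_smulₛₗ, envStar_tmul, star_one]

theorem semilinear_ract (ω : M) (a : A) : s (ract ω a) = lact (star a) (s ω) := by
  unfold lact ract
  rw [s.map_smulₛₗ, envStar_tmul, star_one, MulOpposite.op_one]

theorem semilinear_smul [Module ℂ M] [IsScalarTower ℂ (A ⊗[ℂ] Aᵐᵒᵖ) M] [Module ℂ M']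
    [IsScalarTower ℂ (A ⊗[ℂ] Aᵐᵒᵖ) M'] (c : ℂ) (ω : M) :
    s (c • ω) = star c • s ω := by
  rw [← one_lact (A := A) ω, ← smul_lact, semilinear_lact, semilinear_lact, star_smul, smul_ract]

end Semilinear

end Universal

/-! ### Descent of the involution to `Γ_ε` -/

section Descent

variable {N : ℕ} {q : ℝ} {ε : ℤˣ}

theorem bimoduleRelation_comp {M M' : Type*} [AddCommGroup M] [AddCommGroup M']
    [Module (Sphere N q ⊗[ℂ] (Sphere N q)ᵐᵒᵖ) M] [Module ℂ M]
    [IsScalarTower ℂ (Sphere N q ⊗[ℂ] (Sphere N q)ᵐᵒᵖ) M]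
    [Module (Sphere N q ⊗[ℂ] (Sphere N q)ᵐᵒᵖ) M'] [Module ℂ M']
    [IsScalarTower ℂ (Sphere N q ⊗[ℂ] (Sphere N q)ᵐᵒᵖ) M']
    (φ : M →ₗ[Sphere N q ⊗[ℂ] (Sphere N q)ᵐᵒᵖ] M') (δ : Sphere N q →ₗ[ℂ] M) (i j : Fin N) :
    bimoduleRelation N q ε ((φ.restrictScalars ℂ).comp δ) i j
      = φ (bimoduleRelation N q ε δ i j) := by
  unfold bimoduleRelation lact ract
  simp only [map_sub, map_add, map_sum, LinearMap.map_smul_of_tower, map_smul,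
    LinearMap.comp_apply, LinearMap.restrictScalars_apply]

theorem bimoduleRelation_d (i j : Fin N) : bimoduleRelation N q ε (d N q ε) i j = 0 := by
  unfold d
  rw [bimoduleRelation_comp, Submodule.mkQ_apply, Submodule.Quotient.mk_eq_zero]
  exact Submodule.subset_span ⟨(i, j), rfl⟩

theorem d_mul (a b : Sphere N q) :
    d N q ε (a * b) = ract (d N q ε a) b + lact a (d N q ε b) := by
  unfold d
  rw [LinearMap.comp_apply, universalD_mul, map_add]
  rfl

theorem isFirstOrderCalculus_d : IsFirstOrderCalculus (d N q ε) where
  leibniz := d_mul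
  span ω := by
    obtain ⟨ω, rfl⟩ := (relations N q ε).mkQ_surjective ω
    obtain ⟨n, a, b, rfl⟩ :=
      exists_sum_iff_mem_closure (universalD (Sphere N q)) (universalForms_mem_closure ω)
    refine ⟨n, a, b, ?_⟩
    rw [map_sum]
    rfl

theorem eta_eq : eta N q ε = etaForm (d N q ε) := by
  unfold eta etaForm
  exact Finset.sum_congr rfl fun k _ =>
    sum_C_smul k (fun l => lact (x N q k) (d N q ε (x N q l)))

theorem sum_C_gamma (c : ℂ) (i : Fin N) :
    ∑ j, (C N q i j : ℂ) •
        (d N q ε (x N q j) + c • lact (x N q j) (eta N q ε))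
      = (wt N q i : ℂ) • (d N q ε (x N q i.rev) + c • lact (x N q i.rev) (eta N q ε)) :=
  sum_C_smul i (fun j => d N q ε (x N q j) + c • lact (x N q j) (eta N q ε))

variable [hq : Fact (0 < q)]

theorem star_x_eq (i : Fin N) : star (x N q i) = (wt N q i : ℂ) • x N q i.rev := by
  rw [star_x]
  exact sum_C_smul i (x N q)

theorem star_ofReal (r : ℝ) : star (r : ℂ) = r := Complex.conj_ofReal r

section

variable {M M' : Type*} [AddCommGroup M] [AddCommGroup M']
    [Module (Sphere N q ⊗[ℂ] (Sphere N q)ᵐᵒᵖ) M] [Module ℂ M]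
    [IsScalarTower ℂ (Sphere N q ⊗[ℂ] (Sphere N q)ᵐᵒᵖ) M]
    [Module (Sphere N q ⊗[ℂ] (Sphere N q)ᵐᵒᵖ) M'] [Module ℂ M']
    [IsScalarTower ℂ (Sphere N q ⊗[ℂ] (Sphere N q)ᵐᵒᵖ) M']
    {δ : Sphere N q →ₗ[ℂ] M} {δ' : Sphere N q →ₗ[ℂ] M'}

theorem ract_dx_star_x_star (k l : Fin N) :
    ract (δ (star (x N q l))) (star (x N q k))
      = ((wt N q k : ℂ) * wt N q l) • ract (δ (x N q l.rev)) (x N q k.rev) := by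
  rw [star_x_eq, star_x_eq, map_smul, ract_smul, smul_ract, smul_smul, mul_comm]

/-- Reindexing a tensor under the involution. -/
theorem sum_star_reindex (B B' : Fin N → Fin N → ℝ) (c : ℝ)
    (h : ∀ k l, B k l * (wt N q k * wt N q l) = c * B' l.rev k.rev) :
    ∑ k, ∑ l, (B k l : ℂ) • ract (δ (star (x N q l))) (star (x N q k))
      = (c : ℂ) • ∑ k, ∑ l, (B' k l : ℂ) • ract (δ (x N q k)) (x N q l) := by
  have e : ∀ k l : Fin N, (B k l : ℂ) • ract (δ (star (x N q l))) (star (x N q k))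
      = (c : ℂ) • ((B' l.rev k.rev : ℂ) • ract (δ (x N q l.rev)) (x N q k.rev)) := by
    intro k l
    rw [ract_dx_star_x_star, smul_smul, smul_smul]
    congr 1
    exact_mod_cast congrArg (fun r : ℝ => (r : ℂ)) (h k l)
  simp only [e, Finset.smul_sum]
  rw [Finset.sum_comm]
  refine Fintype.sum_equiv Fin.revPerm _ _ fun l => ?_
  exact Fintype.sum_equiv Fin.revPerm _ _ fun k => rfl

/-- The image of the bimodule relations under an involution. -/
theorem semilinear_bimoduleRelation (hN : 3 ≤ N) (hq1 : q ≠ 1)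
    (s : M →ₛₗ[envStar (Sphere N q)] M') (hs : ∀ a, s (δ a) = δ' (star a))
    (hδ' : ∀ a b, δ' (a * b) = ract (δ' a) b + lact a (δ' b))
    (h : ∀ i j, bimoduleRelation N q ε δ' i j = 0) (i j : Fin N) :
    s (bimoduleRelation N q ε δ i j) = 0 := by
  unfold bimoduleRelation
  simp only [map_sub, map_add, map_sum, semilinear_smul, semilinear_lact, semilinear_ract, hs,
    star_ofReal, star_mul]
  -- The weight symmetries behind `x_i ↦ C^{ij} x_j` being an involution of the sphere also carry
  -- the row `(i, j)` of `R⁻` and `K` to the row `(j', i')`.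
  have hR := sum_star_reindex (δ := δ') (fun k l => Rinv N q k l i j)
    (fun k l => Rinv N q k l j.rev i.rev) _ (fun k l => Rinv_wt N hq.out k l i j)
  have hK := sum_star_reindex (δ := δ') (fun k l => K N q k l i j)
    (fun k l => K N q k l j.rev i.rev) _ (fun k l => K_wt N hq.out k l i j)
  have hC := sum_star_reindex (δ := δ') (fun k l => C N q k l)
    (fun k l => C N q k l) 1 (fun k l => by rw [C_wt N hq.out, one_mul])
  have hθ : ∑ k, ∑ l, (C N q k l : ℂ) • ract (δ' (x N q k)) (x N q l) = -etaForm δ' := by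
    rw [← sum_ract_dx_x hδ']
    exact Finset.sum_congr rfl fun k _ => sum_C_smul k (fun l => ract (δ' (x N q k)) (x N q l))
  have hK' : ∑ k, ∑ l, (K N q k l j.rev i.rev : ℂ) • ract (δ' (x N q k)) (x N q l)
      = -((C N q j.rev i.rev : ℂ) • etaForm δ') := by
    rw [← smul_neg, ← hθ, Finset.smul_sum]
    refine Finset.sum_congr rfl fun k _ => ?_
    rw [Finset.smul_sum]
    refine Finset.sum_congr rfl fun l _ => ?_
    rw [K, Complex.ofReal_mul, mul_smul]
  have hcub : ∑ k, ∑ l, (C N q k l : ℂ) •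
        ract (δ' (star (x N q l))) (star (x N q k) * (star (x N q j) * star (x N q i)))
      = ract (∑ k, ∑ l, (C N q k l : ℂ) • ract (δ' (star (x N q l))) (star (x N q k)))
          (star (x N q j) * star (x N q i)) := by
    simp only [ract_sum, ract_smul, ract_ract]
  rw [hR, hK, hcub, hC, hθ, hK', ract_dx_star_x_star]
  have hxdx : lact (star (x N q j)) (δ' (star (x N q i)))
      = ((wt N q i : ℂ) * wt N q j) • lact (x N q j.rev) (δ' (x N q i.rev)) := by
    rw [star_x_eq, star_x_eq, map_smul, lact_smul, smul_lact, smul_smul]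
  -- Every term now carries the factor given by the weights of `i` and `j`; what is left is the
  -- exchanged relation for `(j', i')`.
  rw [hxdx, lact_x_dx hN hq.out hq1 h, rinvMap_apply, star_x_eq, star_x_eq, smul_mul_smul_comm,
    Complex.ofReal_one, one_smul, ract_neg, smul_ract]
  unfold traceCoeff cubicCoeff
  push_cast
  module

end

/-- The involution of the calculus, semilinear over `a ⊗ b ↦ b^* ⊗ a^*`. -/
def formStar (hN : 3 ≤ N) (hq1 : q ≠ 1) :
    Forms N q ε →ₛₗ[envStar (Sphere N q)] Forms N q ε :=
  Submodule.mapQ (relations N q ε) (relations N q ε) (universalStar (Sphere N q)) (by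
    unfold relations
    rw [Submodule.span_le]
    rintro _ ⟨p, rfl⟩
    -- The source is the universal calculus, but the target is already the quotient, where the
    -- relations hold and `lact_x_dx` is available.
    have := semilinear_bimoduleRelation (δ := universalD (Sphere N q)) (δ' := d N q ε) hN hq1
      ((relations N q ε).mkQ.comp (universalStar (Sphere N q)))
      (fun a => by
        rw [LinearMap.comp_apply, universalStar_universalD]
        rfl) d_mul bimoduleRelation_d p.1 p.2
    rw [LinearMap.comp_apply, Submodule.mkQ_apply, Submodule.Quotient.mk_eq_zero] at this
    exact this)

theorem formStar_d (hN : 3 ≤ N) (hq1 : q ≠ 1) (a : Sphere N q) :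
    formStar hN hq1 (d N q ε a) = d N q ε (star a) := by
  change (relations N q ε).mkQ (universalStar _ (universalD _ a)) = _
  rw [universalStar_universalD]
  rfl

theorem isFormInvolution_formStar (hN : 3 ≤ N) (hq1 : q ≠ 1) :
    IsFormInvolution (d N q ε) (formStar (ε := ε) hN hq1) where
  map_add := map_add _
  map_smul := semilinear_smul _
  map_lact := semilinear_lact _
  map_ract := semilinear_ract _
  map_d := formStar_d hN hq1
  involutive ω := by
    obtain ⟨n, a, b, rfl⟩ := isFirstOrderCalculus_d.span ω
    simp only [map_sum, semilinear_lact, semilinear_ract, formStar_d, star_star]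

theorem isFormInvolution_unique {s s' : Forms N q ε → Forms N q ε}
    (hs : IsFormInvolution (d N q ε) s) (hs' : IsFormInvolution (d N q ε) s') : s' = s := by
  funext ω
  obtain ⟨n, a, b, rfl⟩ := isFirstOrderCalculus_d.span ω
  have e : ∀ {t : Forms N q ε → Forms N q ε}, IsFormInvolution (d N q ε) t →
      t (∑ k, lact (a k) (d N q ε (b k)))
        = ∑ k, ract (d N q ε (star (b k))) (star (a k)) := by
    intro t ht
    have := map_sum (AddMonoidHom.mk' t ht.map_add)
      (fun k => lact (a k) (d N q ε (b k))) Finset.univ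
    simpa only [AddMonoidHom.mk'_apply, ht.map_lact, ht.map_d] using this
  rw [e hs, e hs']

/-- The weights from the two starred generators cancel one of the two factors, which leaves the
contraction of `dx_k x_{k'}` evaluated in `sum_ract_dx_x`. -/
theorem formStar_eta (hN : 3 ≤ N) (hq1 : q ≠ 1) :
    formStar (ε := ε) hN hq1 (eta N q ε) = -etaForm (d N q ε) := by
  rw [eta_eq]
  conv_lhs => rw [etaForm]
  rw [← sum_ract_dx_x d_mul]
  simp only [map_sum, semilinear_smul, semilinear_lact, formStar_d, star_ofReal,
    ract_dx_star_x_star, Fin.rev_rev]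
  refine Finset.sum_congr rfl fun k _ => ?_
  rw [← Complex.ofReal_mul, wt_rev_of_pos N hq.out, Complex.ofReal_one, one_smul]

/-- The image of the one-forms `dx_i + a x_i η` under the involution. -/
theorem formStar_gamma (hN : 3 ≤ N) (hq1 : q ≠ 1) (a : ℝ) (i : Fin N) :
    formStar (ε := ε) hN hq1 (d N q ε (x N q i) + (a : ℂ) • lact (x N q i) (eta N q ε))
      = (wt N q i : ℂ) • ((1 - (a : ℂ) * etaCoeff N q ε) • d N q ε (x N q i.rev)
          - (a : ℂ) • lact (x N q i.rev) (eta N q ε)) := by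
  rw [map_add, semilinear_smul, semilinear_lact, formStar_eta, formStar_d, star_x_eq, map_smul,
    smul_ract, ract_neg, ract_etaForm hN hq.out hq1 bimoduleRelation_d, star_ofReal, eta_eq]
  module

end Descent
end QSphere

end

/-! ### The theorem -/

theorem mainTheorem12 (N : ℕ) (hN : 3 ≤ N) (q : ℝ) [hq : Fact (0 < q)] (hq1 : q ≠ 1) (ε : ℤˣ) :
    QSphere.IsStarCalculus (QSphere.d N q ε) ∧
    ∃ s : QSphere.Forms N q ε → QSphere.Forms N q ε,
      QSphere.IsFormInvolution (QSphere.d N q ε) s ∧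
      (∀ s', QSphere.IsFormInvolution (QSphere.d N q ε) s' → s' = s) ∧
      (∀ i : Fin N, s (QSphere.gammaPlus N q ε i) =
        ((((ε : ℤ) : ℝ) * q⁻¹ : ℝ) : ℂ) •
          ∑ j, (QSphere.C N q i j : ℂ) • QSphere.gammaMinus N q ε j) ∧
      (∀ i : Fin N, s (QSphere.gammaMinus N q ε i) =
        ((((ε : ℤ) : ℝ) * q : ℝ) : ℂ) •
          ∑ j, (QSphere.C N q i j : ℂ) • QSphere.gammaPlus N q ε j) := by
  have hinv := QSphere.isFormInvolution_formStar (ε := ε) hN hq1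
  have hκ := congrArg (fun r : ℝ => (r : ℂ)) (QSphere.alphaPlus_mul_etaCoeff ε hN hq.out hq1)
  have hα := congrArg (fun r : ℝ => (r : ℂ)) (QSphere.alphaMinus_eq (N := N) (q := q) ε)
  have hε := congrArg (fun r : ℝ => (r : ℂ)) (QSphere.sign_sq ε)
  have hqq : (q : ℂ) * (q : ℂ)⁻¹ = 1 := mul_inv_cancel₀ (by exact_mod_cast hq.out.ne')
  push_cast at hκ hα hε
  refine ⟨⟨QSphere.isFirstOrderCalculus_d, fun n a b h => ?_⟩, _, hinv,
    fun s' hs' => QSphere.isFormInvolution_unique hinv hs', fun i => ?_, fun i => ?_⟩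
  · have h0 := congrArg (QSphere.formStar (ε := ε) hN hq1) h
    simpa only [map_sum, map_zero, QSphere.semilinear_lact, QSphere.formStar_d] using h0
  · unfold QSphere.gammaPlus QSphere.gammaMinus
    -- By `hκ`, `1 - α⁺ κ = ε q⁻¹`; and `-α⁺ = ε q⁻¹ α⁻` because `ε² = 1`.
    rw [QSphere.sum_C_gamma, QSphere.formStar_gamma, hκ, hα]
    push_cast
    match_scalars
    · ring
    · linear_combination QSphere.wt N q i * QSphere.alphaPlus N q ε *
        ((q : ℂ) * (q : ℂ)⁻¹ * hε + hqq)
  · unfold QSphere.gammaPlus QSphere.gammaMinus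
    -- Here `1 - α⁻ κ = 1 + ε q (1 - ε q⁻¹) = ε q`.
    rw [QSphere.sum_C_gamma, QSphere.formStar_gamma, hα]
    push_cast
    match_scalars
    · linear_combination QSphere.wt N q i * ((ε : ℤ) : ℂ) * q * hκ
        - QSphere.wt N q i * ((q : ℂ) * (q : ℂ)⁻¹ * hε + hqq)
    · ring
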